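/- Let $\Sigma$ be a smooth manifold with boundary of dimension $n\ge 1$ and let $\mathsf{M}=\mathbb{R}\times\Sigma$, so that $\partial\mathsf{M}=\mathbb{R}\times\partial\Sigma$. For $i=0,1$ let $$g_i=-\beta_i^2\,dt^2\oplus h_i(t)$$ be a Lorentzian metric on $\mathsf{M}$, where $t$ is the coordinate on $\mathbb{R}$, $\beta_i\colon\mathsf{M}\to(0,\infty)$ is smooth and $h_i(t)$ is a Riemannian metric on $\Sigma$ depending smoothly on $t\in\mathbb{R}$. (For example, $(\mathsf{M},g_0)$ and $(\mathsf{M},g_1)$ may be globally hyperbolic manifolds with timelike boundary, split along a common Cauchy temporal function $t$.) On $\mathsf{Z}=[0,1]\times\mathsf{M}$ consider the metric $$g_{\mathsf{Z}}=d\lambda^2\oplus g_\lambda,\qquad g_\lambda=(1-\lambda)g_0+\lambda g_1 .$$ Let $p\in\partial\mathsf{M}$, let $\mathtt{n}_1\in T_p\mathsf{M}$ be the outward unit normal to $\partial\mathsf{M}$ at $p$ with respect to $g_1$, and let $\wp_{1,0}\colon T_{(0,p)}\mathsf{Z}\to T_{(1,p)}\mathsf{Z}$ be the parallel transport for the Levi-Civita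 connection of $g_{\mathsf{Z}}$ along the curve $[0,1]\to\mathsf{Z}$, $\lambda\mapsto(\lambda,p)$. Regard $T\Sigma\subset T\mathsf{M}$ and $T_p\mathsf{M}\subset T_{(\lambda,p)}\mathsf{Z}$ for every $\lambda\in[0,1]$ in the obvious way. Then $\mathtt{n}_1$ and $\wp_{1,0}(\mathtt{n}_1)$ are tangent to $\Sigma$, and $$h_1\bigl(\wp_{1,0}(\mathtt{n}_1),\mathtt{n}_1\bigr)>0 .$$ Consequently $\wp_{1,0}(\mathtt{n}_1)\neq\mu\,\mathtt{n}_1$ for every $\mu<0$. -/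

import Mathlib

open Bundle FiberBundle Set VectorField ContinuousLinearMap
open scoped Manifold ContDiff Topology

set_option linter.unusedSectionVars false

noncomputable section

section PseudoRiemannian

variable {E : Type*} [NormedAddCommGroup E] [NormedSpace ℝ E]
  {H : Type*} [TopologicalSpace H] (I : ModelWithCorners ℝ E H)
  (M : Type*) [TopologicalSpace M] [ChartedSpace H M] [IsManifold I ∞ M]

variable {I M} in
/-- A field of bilinear forms on the tangent spaces of `M` that is smooth, as a section of the
bundle of bilinear forms on `TM`. -/
def IsSmoothForm (b : ∀ x : M, TangentSpace I x →L[ℝ] TangentSpace I x →L[ℝ] ℝ) : Prop :=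
  ContMDiff I (I.prod 𝓘(ℝ, E →L[ℝ] E →L[ℝ] ℝ)) ∞
    (fun x ↦ TotalSpace.mk' (E →L[ℝ] E →L[ℝ] ℝ)
      (E := fun x : M ↦ TangentSpace I x →L[ℝ] TangentSpace I x →L[ℝ] ℝ) x (b x))

/-- A smooth pseudo-Riemannian metric on a manifold, possibly with boundary and corners. -/
structure PseudoRiemannianMetric where
  /-- The bilinear form on each tangent space. -/
  val : ∀ x : M, TangentSpace I x →L[ℝ] TangentSpace I x →L[ℝ] ℝ
  symm : ∀ (x : M) (v w : TangentSpace I x), val x v w = val x w v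
  nondegenerate : ∀ (x : M) (v : TangentSpace I x), (∀ w, val x v w = 0) → v = 0
  isSmooth : IsSmoothForm val

variable {I M}
variable [FiniteDimensional ℝ E] [CompleteSpace E]

/-- A covariant derivative on `TM` is the Levi-Civita connection of `g` if it is torsion-free and
`v (g(Y, Z)) = g(∇_v Y, Z) + g(Y, ∇_v Z)`. (In Mathlib `cov Y x v` stands for `∇_v Y` at `x`.) -/
structure IsLeviCivita (g : PseudoRiemannianMetric I M)
    (cov : CovariantDerivative I E (TangentSpace I : M → Type _)) : Prop where
  torsion_eq_zero : cov.torsion = 0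
  metric : ∀ (x : M) (v : TangentSpace I x) (Y Z : ∀ x : M, TangentSpace I x),
    MDiffAt (T% Y) x → MDiffAt (T% Z) x →
    mvfderiv I (fun y ↦ g.val y (Y y) (Z y)) x v =
      g.val x (cov Y x v) (Z x) + g.val x (Y x) (cov Z x v)

namespace PseudoRiemannianMetric
variable (g : PseudoRiemannianMetric I M)

lemma mdiffAt_pair {x : M} {Y Z : ∀ x : M, TangentSpace I x}
    (hY : MDiffAt (T% Y) x) (hZ : MDiffAt (T% Z) x) :
    MDiffAt (fun y ↦ g.val y (Y y) (Z y)) x := by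
  have := MDifferentiableAt.clm_bundle_apply₂ (F₁ := E) (F₂ := E) (F₃ := ℝ)
    (E₁ := (TangentSpace I : M → Type _)) (E₂ := (TangentSpace I : M → Type _))
    (E₃ := Bundle.Trivial M ℝ) (b := fun y : M ↦ y) (ψ := g.val)
    (ContMDiff.mdifferentiableAt g.isSmooth (by simp)) hY hZ
  exact ((mdifferentiableAt_totalSpace _ _).1 this).2

/-- The right-hand side of the Koszul formula for `2 g(∇_X Y, Z)`. -/
def koszul (X Y Z : ∀ x : M, TangentSpace I x) (x : M) : ℝ :=
  mvfderiv I (fun y ↦ g.val y (Y y) (Z y)) x (X x)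
    + mvfderiv I (fun y ↦ g.val y (X y) (Z y)) x (Y x)
    - mvfderiv I (fun y ↦ g.val y (X y) (Y y)) x (Z x)
    + g.val x (mlieBracket I X Y x) (Z x)
    - g.val x (mlieBracket I X Z x) (Y x)
    - g.val x (mlieBracket I Y Z x) (X x)

variable {g}

lemma koszul_add_left {x : M} {X X' Y Z : ∀ x : M, TangentSpace I x}
    (hX : MDiffAt (T% X) x) (hX' : MDiffAt (T% X') x)
    (hY : MDiffAt (T% Y) x) (hZ : MDiffAt (T% Z) x) :
    g.koszul (X + X') Y Z x = g.koszul X Y Z x + g.koszul X' Y Z x := by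
  have e1 : (fun y ↦ g.val y ((X + X') y) (Z y)) =
      (fun y ↦ g.val y (X y) (Z y)) + fun y ↦ g.val y (X' y) (Z y) := by
    ext y; simp
  have e2 : (fun y ↦ g.val y ((X + X') y) (Y y)) =
      (fun y ↦ g.val y (X y) (Y y)) + fun y ↦ g.val y (X' y) (Y y) := by
    ext y; simp
  simp only [koszul, e1, e2]
  rw [mvfderiv_add (g.mdiffAt_pair hX hZ) (g.mdiffAt_pair hX' hZ),
    mvfderiv_add (g.mdiffAt_pair hX hY) (g.mdiffAt_pair hX' hY),
    mlieBracket_add_left hX hX', mlieBracket_add_left hX hX']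
  simp
  ring

lemma koszul_smul_left {x : M} {f : M → ℝ} {X Y Z : ∀ x : M, TangentSpace I x}
    (hf : MDiffAt f x) (hX : MDiffAt (T% X) x)
    (hY : MDiffAt (T% Y) x) (hZ : MDiffAt (T% Z) x) :
    g.koszul (f • X) Y Z x = f x * g.koszul X Y Z x := by
  have e1 : (fun y ↦ g.val y ((f • X) y) (Z y)) = f * (fun y ↦ g.val y (X y) (Z y)) := by
    ext y; simp
  have e2 : (fun y ↦ g.val y ((f • X) y) (Y y)) = f * (fun y ↦ g.val y (X y) (Y y)) := by
    ext y; simp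
  simp only [koszul, e1, e2]
  rw [mvfderiv_mul hf (g.mdiffAt_pair hX hZ), mvfderiv_mul hf (g.mdiffAt_pair hX hY),
    mlieBracket_smul_left hf hX, mlieBracket_smul_left hf hX]
  simp
  ring

lemma koszul_add_right {x : M} {X Y Z Z' : ∀ x : M, TangentSpace I x}
    (hX : MDiffAt (T% X) x) (hY : MDiffAt (T% Y) x)
    (hZ : MDiffAt (T% Z) x) (hZ' : MDiffAt (T% Z') x) :
    g.koszul X Y (Z + Z') x = g.koszul X Y Z x + g.koszul X Y Z' x := by
  have e1 : (fun y ↦ g.val y (X y) ((Z + Z') y)) =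
      (fun y ↦ g.val y (X y) (Z y)) + fun y ↦ g.val y (X y) (Z' y) := by
    ext y; simp
  have e2 : (fun y ↦ g.val y (Y y) ((Z + Z') y)) =
      (fun y ↦ g.val y (Y y) (Z y)) + fun y ↦ g.val y (Y y) (Z' y) := by
    ext y; simp
  simp only [koszul, e1, e2]
  rw [mvfderiv_add (g.mdiffAt_pair hX hZ) (g.mdiffAt_pair hX hZ'),
    mvfderiv_add (g.mdiffAt_pair hY hZ) (g.mdiffAt_pair hY hZ'),
    mlieBracket_add_right hZ hZ', mlieBracket_add_right hZ hZ']
  simp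
  ring

lemma koszul_smul_right {x : M} {f : M → ℝ} {X Y Z : ∀ x : M, TangentSpace I x}
    (hf : MDiffAt f x) (hX : MDiffAt (T% X) x)
    (hY : MDiffAt (T% Y) x) (hZ : MDiffAt (T% Z) x) :
    g.koszul X Y (f • Z) x = f x * g.koszul X Y Z x := by
  have e1 : (fun y ↦ g.val y (X y) ((f • Z) y)) = f * (fun y ↦ g.val y (X y) (Z y)) := by
    ext y; simp
  have e2 : (fun y ↦ g.val y (Y y) ((f • Z) y)) = f * (fun y ↦ g.val y (Y y) (Z y)) := by
    ext y; simp
  simp only [koszul, e1, e2]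
  rw [mvfderiv_mul hf (g.mdiffAt_pair hX hZ), mvfderiv_mul hf (g.mdiffAt_pair hY hZ),
    mlieBracket_smul_right hf hZ, mlieBracket_smul_right hf hZ]
  simp [g.symm x (Z x)]
  ring

lemma koszul_add_middle {x : M} {X Y Y' Z : ∀ x : M, TangentSpace I x}
    (hX : MDiffAt (T% X) x) (hY : MDiffAt (T% Y) x) (hY' : MDiffAt (T% Y') x)
    (hZ : MDiffAt (T% Z) x) :
    g.koszul X (Y + Y') Z x = g.koszul X Y Z x + g.koszul X Y' Z x := by
  have e1 : (fun y ↦ g.val y ((Y + Y') y) (Z y)) =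
      (fun y ↦ g.val y (Y y) (Z y)) + fun y ↦ g.val y (Y' y) (Z y) := by
    ext y; simp
  have e2 : (fun y ↦ g.val y (X y) ((Y + Y') y)) =
      (fun y ↦ g.val y (X y) (Y y)) + fun y ↦ g.val y (X y) (Y' y) := by
    ext y; simp
  simp only [koszul, e1, e2]
  rw [mvfderiv_add (g.mdiffAt_pair hY hZ) (g.mdiffAt_pair hY' hZ),
    mvfderiv_add (g.mdiffAt_pair hX hY) (g.mdiffAt_pair hX hY'),
    mlieBracket_add_right hY hY', mlieBracket_add_left hY hY']
  simp
  ring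

lemma koszul_smul_middle {x : M} {f : M → ℝ} {X Y Z : ∀ x : M, TangentSpace I x}
    (hf : MDiffAt f x) (hX : MDiffAt (T% X) x)
    (hY : MDiffAt (T% Y) x) (hZ : MDiffAt (T% Z) x) :
    g.koszul X (f • Y) Z x =
      f x * g.koszul X Y Z x + 2 * mvfderiv I f x (X x) * g.val x (Y x) (Z x) := by
  have e1 : (fun y ↦ g.val y ((f • Y) y) (Z y)) = f * (fun y ↦ g.val y (Y y) (Z y)) := by
    ext y; simp
  have e2 : (fun y ↦ g.val y (X y) ((f • Y) y)) = f * (fun y ↦ g.val y (X y) (Y y)) := by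
    ext y; simp
  simp only [koszul, e1, e2]
  rw [mvfderiv_mul hf (g.mdiffAt_pair hY hZ), mvfderiv_mul hf (g.mdiffAt_pair hX hY),
    mlieBracket_smul_right hf hY, mlieBracket_smul_left hf hY]
  simp [g.symm x (Y x) (X x)]
  ring

lemma koszul_sub_swap (X Y Z : ∀ x : M, TangentSpace I x) (x : M) :
    g.koszul X Y Z x - g.koszul Y X Z x = 2 * g.val x (mlieBracket I X Y x) (Z x) := by
  have e : (fun y ↦ g.val y (Y y) (X y)) = fun y ↦ g.val y (X y) (Y y) := by
    ext y; exact g.symm y _ _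
  simp only [koszul, e, mlieBracket_swap_apply (V := Y) (W := X)]
  simp
  ring

lemma koszul_add_swap (X Y Z : ∀ x : M, TangentSpace I x) (x : M) :
    g.koszul X Y Z x + g.koszul X Z Y x =
      2 * mvfderiv I (fun y ↦ g.val y (Y y) (Z y)) x (X x) := by
  have e : (fun y ↦ g.val y (Z y) (Y y)) = fun y ↦ g.val y (Y y) (Z y) := by
    ext y; exact g.symm y _ _
  simp only [koszul, e, mlieBracket_swap_apply (V := Z) (W := Y)]
  simp
  ring

variable (g) in
lemma exists_koszul {x : M} {Y : ∀ x : M, TangentSpace I x} (hY : MDiffAt (T% Y) x) :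
    ∃ A : TangentSpace I x →L[ℝ] TangentSpace I x, ∀ X Z : ∀ x : M, TangentSpace I x,
      MDiffAt (T% X) x → MDiffAt (T% Z) x → 2 * g.val x (A (X x)) (Z x) = g.koszul X Y Z x := by
  have : FiniteDimensional ℝ (TangentSpace I x) := inferInstanceAs (FiniteDimensional ℝ E)
  have : T2Space (TangentSpace I x) := inferInstanceAs (T2Space E)
  let B := TensorialAt.mkHom₂ (I := I) (F := E) (F' := E) (fun X Z ↦ g.koszul X Y Z x) x
    (fun Z hZ ↦ ⟨fun hf hX ↦ koszul_smul_left hf hX hY hZ,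
      fun hX hX' ↦ koszul_add_left hX hX' hY hZ⟩)
    (fun X hX ↦ ⟨fun hf hZ ↦ koszul_smul_right hf hX hY hZ,
      fun hZ hZ' ↦ koszul_add_right hX hY hZ hZ'⟩)
  let G : TangentSpace I x →ₗ[ℝ] (TangentSpace I x →ₗ[ℝ] ℝ) :=
    ContinuousLinearMap.coeLM ℝ ∘ₗ (g.val x).toLinearMap
  have hG : Function.Injective G := by
    rw [injective_iff_map_eq_zero]
    intro v hv
    exact g.nondegenerate x v fun w ↦ by simpa [G] using congr($hv w)
  let Ge : TangentSpace I x ≃ₗ[ℝ] (TangentSpace I x →ₗ[ℝ] ℝ) :=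
    LinearEquiv.ofInjectiveOfFinrankEq G hG (by simp [Subspace.dual_finrank_eq])
  have hGe : ∀ v w, Ge v w = g.val x v w := fun v w ↦ by
    have : Ge v = G v := congr($(LinearEquiv.coe_ofInjectiveOfFinrankEq G hG _) v)
    rw [this]; simp [G]
  refine ⟨LinearMap.toContinuousLinearMap
    ((1 / 2 : ℝ) • Ge.symm.toLinearMap ∘ₗ ContinuousLinearMap.coeLM ℝ ∘ₗ B.toLinearMap), ?_⟩
  intro X Z hX hZ
  rw [← hGe]
  have hB : B (X x) (Z x) = g.koszul X Y Z x := TensorialAt.mkHom₂_apply _ _ hX hZ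
  simp [hB]

open scoped Classical in
variable (g) in
/-- Every pseudo-Riemannian metric has a Levi-Civita connection. -/
theorem exists_isLeviCivita :
    ∃ cov : CovariantDerivative I E (TangentSpace I : M → Type _), IsLeviCivita g cov := by
  let D : (∀ x : M, TangentSpace I x) → ∀ x : M, TangentSpace I x →L[ℝ] TangentSpace I x :=
    fun Y x ↦ if hY : MDiffAt (T% Y) x then (g.exists_koszul hY).choose else 0
  have hD : ∀ {X Y Z : ∀ x : M, TangentSpace I x} {x : M}, MDiffAt (T% X) x → MDiffAt (T% Y) x →
      MDiffAt (T% Z) x → 2 * g.val x (D Y x (X x)) (Z x) = g.koszul X Y Z x := by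
    intro X Y Z x hX hY hZ
    simp only [D, dif_pos hY]
    exact (g.exists_koszul hY).choose_spec X Z hX hZ
  have key : ∀ {x : M} (A A' : TangentSpace I x →L[ℝ] TangentSpace I x),
      (∀ X Z : ∀ x : M, TangentSpace I x, MDiffAt (T% X) x → MDiffAt (T% Z) x →
        2 * g.val x (A (X x)) (Z x) = 2 * g.val x (A' (X x)) (Z x)) → A = A' := by
    intro x A A' h
    ext1 v
    rw [← sub_eq_zero]
    refine g.nondegenerate x _ fun w ↦ ?_
    have := h (extend E v) (extend E w) (mdifferentiableAt_extend ..) (mdifferentiableAt_extend ..)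
    simp only [extend_apply_self] at this
    simp only [map_sub, sub_apply]
    linarith
  have hcov : IsCovariantDerivativeOn E D univ := by
    refine ⟨fun {Y Y' x} hY hY' _ ↦ key _ _ fun X Z hX hZ ↦ ?_,
      fun {Y f x} hY hf _ ↦ key _ _ fun X Z hX hZ ↦ ?_⟩
    · rw [hD hX (mdifferentiableAt_add_section hY hY') hZ, koszul_add_middle hX hY hY' hZ,
        ← hD hX hY hZ, ← hD hX hY' hZ]
      simp
      ring
    · rw [hD hX (hf.smul_section hY) hZ, koszul_smul_middle hf hX hY hZ, ← hD hX hY hZ]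
      simp
      ring
  refine ⟨⟨D, hcov⟩, ?_, ?_⟩
  · rw [CovariantDerivative.torsion_eq_zero_iff]
    intro X Y x hX hY
    rw [← sub_eq_zero]
    refine g.nondegenerate x _ fun w ↦ ?_
    have hw := mdifferentiableAt_extend I E (V := (TangentSpace I : M → Type _)) w
    have h1 := hD hX hY hw
    have h2 := hD hY hX hw
    have h3 := g.koszul_sub_swap X Y (extend E w) x
    simp only [extend_apply_self] at h1 h2 h3
    simp only [map_sub, sub_apply]
    linarith
  · intro x v Y Z hY hZ
    have hv := mdifferentiableAt_extend I E (V := (TangentSpace I : M → Type _)) v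
    have h1 := hD hv hY hZ
    have h2 := hD hv hZ hY
    have h3 := g.koszul_add_swap (extend E v) Y Z x
    simp only [extend_apply_self] at h1 h2 h3
    have h4 := g.symm x (D Z x v) (Y x)
    change _ = g.val x (D Y x v) (Z x) + g.val x (Y x) (D Z x v)
    linarith

variable (g) in
/-- The Levi-Civita connection of `g`. -/
def leviCivita : CovariantDerivative I E (TangentSpace I : M → Type _) :=
  g.exists_isLeviCivita.choose

variable (g) in
theorem isLeviCivita_leviCivita : IsLeviCivita g g.leviCivita :=
  g.exists_isLeviCivita.choose_spec

end PseudoRiemannianMetric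

/-- The Koszul formula; in particular the Levi-Civita connection is unique. -/
theorem IsLeviCivita.two_mul_val {g : PseudoRiemannianMetric I M}
    {cov : CovariantDerivative I E (TangentSpace I : M → Type _)}
    (h : IsLeviCivita g cov) {X Y Z : ∀ x : M, TangentSpace I x} {x : M}
    (hX : MDiffAt (T% X) x) (hY : MDiffAt (T% Y) x) (hZ : MDiffAt (T% Z) x) :
    2 * g.val x (cov Y x (X x)) (Z x) = g.koszul X Y Z x := by
  have ht := fun {X Y : ∀ x : M, TangentSpace I x} {x : M} hX hY ↦
    (cov.torsion_eq_zero_iff.1 h.torsion_eq_zero (X := X) (Y := Y) (x := x) hX hY).symm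
  simp only [PseudoRiemannianMetric.koszul, ht hX hY, ht hX hZ, ht hY hZ, h.metric x _ _ _ hY hZ, h.metric x _ _ _ hX hZ,
    h.metric x _ _ _ hX hY, map_sub, sub_apply]
  rw [g.symm x (Y x), g.symm x (X x) (cov Z x (Y x)), g.symm x (X x) (cov Y x (Z x))]
  ring

end PseudoRiemannian

section Pullback

variable {E : Type*} [NormedAddCommGroup E] [NormedSpace ℝ E]
  {H : Type*} [TopologicalSpace H] (I : ModelWithCorners ℝ E H)
  {M : Type*} [TopologicalSpace M] [ChartedSpace H M] 
  {E' : Type*} [NormedAddCommGroup E'] [NormedSpace ℝ E']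
  {H' : Type*} [TopologicalSpace H'] (I' : ModelWithCorners ℝ E' H')
  {M' : Type*} [TopologicalSpace M'] [ChartedSpace H' M']

/-- The pullback to `T_x M` of a bilinear form on `T_{f x} M'` under the differential of `f`. -/
def pullbackForm (f : M → M') (x : M)
    (b : TangentSpace I' (f x) →L[ℝ] TangentSpace I' (f x) →L[ℝ] ℝ) :
    TangentSpace I x →L[ℝ] TangentSpace I x →L[ℝ] ℝ :=
  ContinuousLinearMap.precomp ℝ (mfderiv I I' f x) ∘L (b ∘L mfderiv I I' f x)

@[simp]
lemma pullbackForm_apply (f : M → M') (x : M)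
    (b : TangentSpace I' (f x) →L[ℝ] TangentSpace I' (f x) →L[ℝ] ℝ) (v w : TangentSpace I x) :
    pullbackForm I I' f x b v w = b (mfderiv I I' f x v) (mfderiv I I' f x w) :=
  rfl

variable [IsManifold I ∞ M] [IsManifold I' ∞ M']

theorem contMDiff_pullbackForm {f : M → M'} (hf : ContMDiff I I' ∞ f)
    (b : ∀ x : M, TangentSpace I' (f x) →L[ℝ] TangentSpace I' (f x) →L[ℝ] ℝ)
    (hb : ContMDiff I (I'.prod 𝓘(ℝ, E' →L[ℝ] E' →L[ℝ] ℝ)) ∞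
      (fun x ↦ TotalSpace.mk' (E' →L[ℝ] E' →L[ℝ] ℝ)
        (E := fun y : M' ↦ TangentSpace I' y →L[ℝ] TangentSpace I' y →L[ℝ] ℝ) (f x) (b x))) :
    ContMDiff I (I.prod 𝓘(ℝ, E →L[ℝ] E →L[ℝ] ℝ)) ∞
      (fun x ↦ TotalSpace.mk' (E →L[ℝ] E →L[ℝ] ℝ)
        (E := fun y : M ↦ TangentSpace I y →L[ℝ] TangentSpace I y →L[ℝ] ℝ) x
        (pullbackForm I I' f x (b x))) := by
  intro x₀
  rw [contMDiffAt_hom_bundle]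
  refine ⟨contMDiffAt_id, ?_⟩
  have hB := ((contMDiffAt_hom_bundle _).1 (hb x₀)).2
  have hA := (hf x₀).mfderiv_const (m := ∞) (by simp)
  have hΦ : ContDiff ℝ ∞ (fun q : (E →L[ℝ] E') × (E' →L[ℝ] E' →L[ℝ] ℝ) ↦
      ((ContinuousLinearMap.compL ℝ E E' ℝ).flip q.1) ∘L (q.2 ∘L q.1)) :=
    ((ContinuousLinearMap.contDiff _).comp contDiff_fst).clm_comp (contDiff_snd.clm_comp contDiff_fst)
  have := (hΦ.contMDiff.contMDiffAt).comp x₀ (hA.prodMk_space hB)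
  refine this.congr_of_eventuallyEq ?_
  have h1 : ∀ᶠ x in 𝓝 x₀, x ∈ (trivializationAt E (TangentSpace I : M → Type _) x₀).baseSet :=
    (trivializationAt E (TangentSpace I : M → Type _) x₀).open_baseSet.mem_nhds
      (mem_baseSet_trivializationAt ..)
  have h2 : ∀ᶠ x in 𝓝 x₀,
      f x ∈ (trivializationAt E' (TangentSpace I' : M' → Type _) (f x₀)).baseSet :=
    hf.continuous.continuousAt.eventually
      ((trivializationAt E' (TangentSpace I' : M' → Type _) (f x₀)).open_baseSet.mem_nhds
        (mem_baseSet_trivializationAt ..))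
  filter_upwards [h1, h2] with x hx hfx
  ext v w
  rw [inCoordinates_apply_eq₂ hx hx (by simp)]
  simp only [Function.comp_apply, ContinuousLinearMap.comp_apply, ContinuousLinearMap.flip_apply,
    ContinuousLinearMap.compL_apply]
  rw [inCoordinates_apply_eq₂ hfx hfx (by simp)]
  have key : ∀ u, (trivializationAt E' (TangentSpace I' : M' → Type _) (f x₀)).symm (f x)
      (inTangentCoordinates I I' id f (mfderiv I I' f) x₀ x u) =
      mfderiv I I' f x ((trivializationAt E (TangentSpace I : M → Type _) x₀).symm x u) := by
    intro u
    change (trivializationAt E' (TangentSpace I' : M' → Type _) (f x₀)).symm (f x)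
      (inCoordinates E (TangentSpace I) E' (TangentSpace I') x₀ x (f x₀) (f x)
        (mfderiv I I' f x) u) = _
    rw [inCoordinates_eq hx hfx]
    simpa using Trivialization.symm_apply_apply_mk _ hfx _
  rw [key, key]
  simp [pullbackForm]

variable {I} in
lemma contMDiff_mulForm {f : M → ℝ} (hf : ContMDiff I 𝓘(ℝ, ℝ) ∞ f) :
    ContMDiff I (I.prod 𝓘(ℝ, E →L[ℝ] E →L[ℝ] ℝ)) ∞
      (fun x ↦ TotalSpace.mk' (E →L[ℝ] E →L[ℝ] ℝ)
        (E := fun y : M ↦ TangentSpace I y →L[ℝ] TangentSpace I y →L[ℝ] ℝ) x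
        (pullbackForm I 𝓘(ℝ, ℝ) f x (ContinuousLinearMap.mul ℝ ℝ))) := by
  apply contMDiff_pullbackForm I 𝓘(ℝ, ℝ) hf (fun _ ↦ (ContinuousLinearMap.mul ℝ ℝ))
  intro x₀
  rw [contMDiffAt_hom_bundle]
  refine ⟨hf x₀, ?_⟩
  refine (contMDiffAt_const (c := ContinuousLinearMap.mul ℝ ℝ)).congr_of_eventuallyEq (.of_forall fun x ↦ ?_)
  ext
  rw [inCoordinates_apply_eq₂ (by simp [chartAt_self_eq]) (by simp [chartAt_self_eq]) (by simp)]
  have h : (trivializationAt ℝ (TangentSpace 𝓘(ℝ, ℝ) : ℝ → Type _) (f x₀)).symm (f x) 1 =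
      (1 : ℝ) := by
    rw [← Trivialization.symmL_apply (R := ℝ), TangentBundle.symmL_model_space]
    · rfl
    · simp [chartAt_self_eq]
  rw [h]
  simp only [Trivial.fiberBundle_trivializationAt', Trivial.linearMapAt_trivialization]
  rfl


variable {I} in
lemma IsSmoothForm.add {b c : ∀ x : M, TangentSpace I x →L[ℝ] TangentSpace I x →L[ℝ] ℝ}
    (hb : IsSmoothForm b) (hc : IsSmoothForm c) : IsSmoothForm (fun x ↦ b x + c x) :=
  ContMDiff.add_section hb hc

variable {I} in
lemma IsSmoothForm.smul {f : M → ℝ} {b : ∀ x : M, TangentSpace I x →L[ℝ] TangentSpace I x →L[ℝ] ℝ}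
    (hf : ContMDiff I 𝓘(ℝ, ℝ) ∞ f) (hb : IsSmoothForm b) : IsSmoothForm (fun x ↦ f x • b x) :=
  ContMDiff.smul_section hf hb

end Pullback

section ParallelTransport

variable {E : Type*} [NormedAddCommGroup E] [NormedSpace ℝ E]
  {H : Type*} [TopologicalSpace H] {I : ModelWithCorners ℝ E H}
  {M : Type*} [TopologicalSpace M] [ChartedSpace H M] [IsManifold I ∞ M]
  (cov : CovariantDerivative I E (TangentSpace I : M → Type _)) 
  (γ : Icc (0 : ℝ) 1 → M)

/-- The velocity of a curve `[0,1] → M`. -/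
def velocity (s : Icc (0 : ℝ) 1) : TangentSpace I (γ s) := mfderiv (𝓡∂ 1) I γ s 1

variable {γ} in
/-- The covariant derivative `DV/ds` of a vector field `V` along the curve `γ`. In the
trivialization `e` of `TM` over the chart at `γ s`, with frame `eᵢ` and `V = ∑ Vⁱ eᵢ`, it is
`∑ (dVⁱ/ds) eᵢ + ∑ Vⁱ ∇_{γ'} eᵢ`; here `extend E (V s)` is the field `∑ Vⁱ(s) eᵢ` with constant
coefficients. -/
def covDerivAlong (V : ∀ s, TangentSpace I (γ s)) (s : Icc (0 : ℝ) 1) : TangentSpace I (γ s) :=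
  let e := trivializationAt E (TangentSpace I : M → Type _) (γ s)
  e.symm (γ s) (mfderiv (𝓡∂ 1) 𝓘(ℝ, E) (fun r ↦ (e ⟨γ r, V r⟩).2) s 1)
    + cov (extend E (V s)) (γ s) (velocity γ s)

/-- A differentiable vector field along `γ` with vanishing covariant derivative. -/
structure IsParallelAlong (V : ∀ s, TangentSpace I (γ s)) : Prop where
  mdifferentiable : MDifferentiable (𝓡∂ 1) (I.prod 𝓘(ℝ, E))
    (fun s ↦ (⟨γ s, V s⟩ : TangentBundle I M))
  covDerivAlong_eq_zero : ∀ s, covDerivAlong cov V s = 0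

open scoped Classical in
/-- Parallel transport along the curve `γ`, from `γ 0` to `γ 1`: the value at `1` of the parallel
field along `γ` which starts at `v`. (The value is `0` if no such field exists.) -/
def parallelTransport (v : TangentSpace I (γ 0)) : TangentSpace I (γ 1) :=
  if h : ∃ V : ∀ s, TangentSpace I (γ s), IsParallelAlong cov γ V ∧ V 0 = v then h.choose 1 else 0

end ParallelTransport

section Split


variable (n : ℕ) [NeZero n] 
   (S : Type*) [TopologicalSpace S] [ChartedSpace (EuclideanHalfSpace n) S]

/-- The model of `ℝ × S`, for `S` an `n`-manifold with boundary. -/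
abbrev spacetimeModel := 𝓘(ℝ, ℝ).prod (𝓡∂ n)

/-- The model of `[0,1] × (ℝ × S)`. -/
abbrev cylinderModel := (𝓡∂ 1).prod (spacetimeModel n)

variable [IsManifold (𝓡∂ n) ∞ S]

/-- The data of a metric `-β² dt² ⊕ h(t)` on `ℝ × S`: a smooth function `β > 0` on `ℝ × S`, and
Riemannian metrics `h(t)` on `S` depending smoothly on `t`, where `spatial (t, x)` is `h(t)` at
`x`. -/
structure SplitMetric where
  lapse : ℝ × S → ℝ
  lapse_pos : ∀ p, 0 < lapse p
  lapse_contMDiff : ContMDiff (spacetimeModel n) 𝓘(ℝ, ℝ) ∞ lapse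
  spatial : ∀ p : ℝ × S, TangentSpace (𝓡∂ n) p.2 →L[ℝ] TangentSpace (𝓡∂ n) p.2 →L[ℝ] ℝ
  spatial_symm : ∀ p v w, spatial p v w = spatial p w v
  spatial_pos : ∀ p v, v ≠ 0 → 0 < spatial p v v
  spatial_contMDiff : ContMDiff (spacetimeModel n)
    ((𝓡∂ n).prod 𝓘(ℝ, EuclideanSpace ℝ (Fin n) →L[ℝ] EuclideanSpace ℝ (Fin n) →L[ℝ] ℝ)) ∞
    (fun p ↦ TotalSpace.mk' (EuclideanSpace ℝ (Fin n) →L[ℝ] EuclideanSpace ℝ (Fin n) →L[ℝ] ℝ)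
      (E := fun x : S ↦ TangentSpace (𝓡∂ n) x →L[ℝ] TangentSpace (𝓡∂ n) x →L[ℝ] ℝ)
      p.2 (spatial p))

namespace SplitMetric
variable {n S} (G : SplitMetric n S) (G₀ G₁ : SplitMetric n S)

/-- The metric `g = -β² dt² ⊕ h(t)` on `ℝ × S`. -/
def spacetimeForm (p : ℝ × S) :
    TangentSpace (spacetimeModel n) p →L[ℝ] TangentSpace (spacetimeModel n) p →L[ℝ] ℝ :=
  -(G.lapse p ^ 2) • pullbackForm (spacetimeModel n) 𝓘(ℝ, ℝ) Prod.fst p (ContinuousLinearMap.mul ℝ ℝ)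
    + pullbackForm (spacetimeModel n) (𝓡∂ n) Prod.snd p (G.spatial p)

/-- The bilinear form `dλ² ⊕ ((1 - λ) g₀ + λ g₁)` on `[0,1] × (ℝ × S)`, where `λ` is the first
coordinate. -/
def cylinderForm (z : Icc (0 : ℝ) 1 × (ℝ × S)) :
    TangentSpace (cylinderModel n) z →L[ℝ] TangentSpace (cylinderModel n) z →L[ℝ] ℝ :=
  pullbackForm (cylinderModel n) 𝓘(ℝ, ℝ) (fun z : Icc (0 : ℝ) 1 × (ℝ × S) ↦ (z.1 : ℝ)) z (ContinuousLinearMap.mul ℝ ℝ)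
    + pullbackForm (cylinderModel n) (spacetimeModel n) Prod.snd z
      ((1 - (z.1 : ℝ)) • G₀.spacetimeForm z.2 + (z.1 : ℝ) • G₁.spacetimeForm z.2)

lemma isSmoothForm_spacetimeForm : IsSmoothForm G.spacetimeForm :=
  .add (.smul (G.lapse_contMDiff.pow 2).neg (contMDiff_mulForm contMDiff_fst))
    (contMDiff_pullbackForm _ _ contMDiff_snd _ G.spatial_contMDiff)

lemma isSmoothForm_cylinderForm : IsSmoothForm (G₀.cylinderForm G₁) := by
  have hl : ContMDiff (cylinderModel n) 𝓘(ℝ, ℝ) ∞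
      (fun z : Icc (0 : ℝ) 1 × (ℝ × S) ↦ (z.1 : ℝ)) :=
    contMDiff_subtypeVal_Icc.comp contMDiff_fst
  have h : ∀ G : SplitMetric n S, IsSmoothForm fun z : Icc (0 : ℝ) 1 × (ℝ × S) ↦
      pullbackForm (cylinderModel n) (spacetimeModel n) Prod.snd z (G.spacetimeForm z.2) :=
    fun G ↦ contMDiff_pullbackForm _ _ contMDiff_snd _
      (G.isSmoothForm_spacetimeForm.comp contMDiff_snd)
  convert IsSmoothForm.add (contMDiff_mulForm hl)
    (.add (.smul (contMDiff_const (c := (1 : ℝ)).sub hl) (h G₀)) (.smul hl (h G₁))) using 3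
  ext v w
  rfl

lemma cylinderForm_apply (z : Icc (0 : ℝ) 1 × (ℝ × S))
    (v w : EuclideanSpace ℝ (Fin 1) × (ℝ × EuclideanSpace ℝ (Fin n))) :
    G₀.cylinderForm G₁ z v w =
      ContinuousLinearMap.mul ℝ ℝ (mfderiv (𝓡∂ 1) 𝓘(ℝ, ℝ) Subtype.val z.1 v.1)
        (mfderiv (𝓡∂ 1) 𝓘(ℝ, ℝ) Subtype.val z.1 w.1)
      + ((1 - (z.1 : ℝ)) * (-(G₀.lapse z.2 ^ 2) * (v.2.1 * w.2.1) + G₀.spatial z.2 v.2.2 w.2.2)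
      + (z.1 : ℝ) * (-(G₁.lapse z.2 ^ 2) * (v.2.1 * w.2.1) + G₁.spatial z.2 v.2.2 w.2.2)) := by
  have h1 : mfderiv (cylinderModel n) 𝓘(ℝ, ℝ) (fun z : Icc (0 : ℝ) 1 × (ℝ × S) ↦ (z.1 : ℝ)) z =
      (mfderiv (𝓡∂ 1) 𝓘(ℝ, ℝ) Subtype.val z.1) ∘L 
      mfderiv (cylinderModel n) (𝓡∂ 1) Prod.fst z :=
    mfderiv_comp (I' := 𝓡∂ 1) z (contMDiff_subtypeVal_Icc (n := 1) _ |>.mdifferentiableAt (by simp))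
      mdifferentiableAt_fst
  have h2 : ∀ (G : SplitMetric n S) (p : ℝ × S) (v w : ℝ × EuclideanSpace ℝ (Fin n)), 
      G.spacetimeForm p v w = -(G.lapse p ^ 2) * (v.1 * w.1) + G.spatial p v.2 w.2 := by
    intro G p v w
    change -(G.lapse p ^ 2) * ContinuousLinearMap.mul ℝ ℝ
      (mfderiv (spacetimeModel n) 𝓘(ℝ, ℝ) Prod.fst p v)
      (mfderiv (spacetimeModel n) 𝓘(ℝ, ℝ) Prod.fst p w) 
      + G.spatial p (mfderiv (spacetimeModel n) (𝓡∂ n) Prod.snd p v) 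
        (mfderiv (spacetimeModel n) (𝓡∂ n) Prod.snd p w) = _
    rw [mfderiv_fst, mfderiv_snd]
    rfl
  rw [← h2, ← h2]
  change ContinuousLinearMap.mul ℝ ℝ
      (mfderiv (cylinderModel n) 𝓘(ℝ, ℝ) (fun z : Icc (0 : ℝ) 1 × (ℝ × S) ↦ (z.1 : ℝ)) z v)
      (mfderiv (cylinderModel n) 𝓘(ℝ, ℝ) (fun z : Icc (0 : ℝ) 1 × (ℝ × S) ↦ (z.1 : ℝ)) z w) 
    + ((1 - (z.1 : ℝ)) * G₀.spacetimeForm z.2 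
        (mfderiv (cylinderModel n) (spacetimeModel n) Prod.snd z v)
        (mfderiv (cylinderModel n) (spacetimeModel n) Prod.snd z w)
      + (z.1 : ℝ) * G₁.spacetimeForm z.2 
        (mfderiv (cylinderModel n) (spacetimeModel n) Prod.snd z v)
        (mfderiv (cylinderModel n) (spacetimeModel n) Prod.snd z w)) = _
  rw [h1, mfderiv_fst, mfderiv_snd]
  rfl

lemma cylinderForm_nondegenerate (z : Icc (0 : ℝ) 1 × (ℝ × S))
    (v : TangentSpace (cylinderModel n) z)
    (hv : ∀ w, G₀.cylinderForm G₁ z v w = 0) : v = 0 := by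
  obtain ⟨a, b, u⟩ : EuclideanSpace ℝ (Fin 1) × (ℝ × EuclideanSpace ℝ (Fin n)) := v
  have h := (G₀.cylinderForm_apply G₁ z (a, (b, u)) (a, (-b, u))).symm.trans (hv (a, (-b, u)))
  have hL : Function.Injective (mfderiv (𝓡∂ 1) 𝓘(ℝ, ℝ) Subtype.val z.1) := by
    have hs : Function.Surjective (mfderiv (𝓡∂ 1) 𝓘(ℝ, ℝ) Subtype.val z.1) := fun c ↦
      ⟨(show ℝ from c) • (1 : TangentSpace (𝓡∂ 1) z.1), by
        rw [map_smul, mfderiv_subtypeVal_Icc_one]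
        exact mul_one (show ℝ from c)⟩
    let L : EuclideanSpace ℝ (Fin 1) →L[ℝ] ℝ := mfderiv (𝓡∂ 1) 𝓘(ℝ, ℝ) Subtype.val z.1
    exact (LinearMap.injective_iff_surjective_of_finrank_eq_finrank (f := L.toLinearMap)
      (by simp)).2 hs
  set d : ℝ := mfderiv (𝓡∂ 1) 𝓘(ℝ, ℝ) Subtype.val z.1 a with hd
  have hsp : ∀ G : SplitMetric n S, 0 ≤ G.spatial z.2 u u := fun G ↦ by
    rcases eq_or_ne u 0 with rfl | hu
    · exact (map_zero (G.spatial z.2 0)).ge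
    · exact (G.spatial_pos z.2 u hu).le
  have h' : d * d + ((1 - (z.1 : ℝ)) * (G₀.lapse z.2 ^ 2 * b ^ 2 + G₀.spatial z.2 u u) +
      (z.1 : ℝ) * (G₁.lapse z.2 ^ 2 * b ^ 2 + G₁.spatial z.2 u u)) = 0 := by
    refine Eq.trans ?_ h
    change _ = d * d + ((1 - (z.1 : ℝ)) * (-(G₀.lapse z.2 ^ 2) * (b * -b) + G₀.spatial z.2 u u) +
      (z.1 : ℝ) * (-(G₁.lapse z.2 ^ 2) * (b * -b) + G₁.spatial z.2 u u))
    ring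
  have hz0 : 0 ≤ (z.1 : ℝ) := z.1.2.1
  have hz1 : 0 ≤ 1 - (z.1 : ℝ) := sub_nonneg.2 z.1.2.2
  have hnn : ∀ G : SplitMetric n S, 0 ≤ G.lapse z.2 ^ 2 * b ^ 2 + G.spatial z.2 u u := fun G ↦
    add_nonneg (by positivity) (hsp G)
  have hd0 : d = 0 := by
    have := mul_nonneg hz1 (hnn G₀)
    have := mul_nonneg hz0 (hnn G₁)
    nlinarith [mul_self_nonneg d]
  have hbu : b = 0 ∧ u = 0 := by
    by_contra hne
    have hpos : ∀ G : SplitMetric n S, 0 < G.lapse z.2 ^ 2 * b ^ 2 + G.spatial z.2 u u := by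
      intro G
      have hl := G.lapse_pos z.2
      rcases eq_or_ne b 0 with hb | hb
      · exact add_pos_of_nonneg_of_pos (by positivity)
          (G.spatial_pos z.2 u fun hu ↦ hne ⟨hb, hu⟩)
      · exact add_pos_of_pos_of_nonneg (by positivity) (hsp G)
    have hm : 0 < min (G₀.lapse z.2 ^ 2 * b ^ 2 + G₀.spatial z.2 u u)
        (G₁.lapse z.2 ^ 2 * b ^ 2 + G₁.spatial z.2 u u) := lt_min (hpos G₀) (hpos G₁)
    have h0 := mul_le_mul_of_nonneg_left (min_le_left (G₀.lapse z.2 ^ 2 * b ^ 2 +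
      G₀.spatial z.2 u u) (G₁.lapse z.2 ^ 2 * b ^ 2 + G₁.spatial z.2 u u)) hz1
    have h1 := mul_le_mul_of_nonneg_left (min_le_right (G₀.lapse z.2 ^ 2 * b ^ 2 +
      G₀.spatial z.2 u u) (G₁.lapse z.2 ^ 2 * b ^ 2 + G₁.spatial z.2 u u)) hz0
    nlinarith [mul_self_nonneg d]
  have ha : a = 0 := hL (hd0.trans (map_zero _).symm)
  obtain ⟨rfl, rfl⟩ := hbu
  rw [ha]
  rfl

/-- The metric `g_Z = dλ² ⊕ ((1 - λ) g₀ + λ g₁)` on `Z = [0,1] × (ℝ × S)`. -/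
def cylinderMetric :
    PseudoRiemannianMetric (cylinderModel n) (Icc (0 : ℝ) 1 × (ℝ × S)) where
  val := G₀.cylinderForm G₁
  symm z v w := by
    refine (G₀.cylinderForm_apply G₁ z v w).trans
      (.trans ?_ (G₀.cylinderForm_apply G₁ z w v).symm)
    obtain ⟨a, b, u⟩ : EuclideanSpace ℝ (Fin 1) × (ℝ × EuclideanSpace ℝ (Fin n)) := v
    obtain ⟨a', b', u'⟩ : EuclideanSpace ℝ (Fin 1) × (ℝ × EuclideanSpace ℝ (Fin n)) := w
    have h0 := G₀.spatial_symm z.2 u u'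
    have h1 := G₁.spatial_symm z.2 u u'
    dsimp only
    rw [h0, h1, mul_comm b b']
    exact congrArg (· + _) (mul_comm (G := ℝ) _ _)
  nondegenerate := G₀.cylinderForm_nondegenerate G₁
  isSmooth := G₀.isSmoothForm_cylinderForm G₁

end SplitMetric

variable {n S}

/-- The differential at `x` of the `0`-th coordinate of the chart at `x`. The model is the half
space `x⁰ ≥ 0`, so for `x` in the boundary of `S` the tangent space of the boundary is the kernel,
and the vectors on which it is negative point outwards. -/
def boundaryCoord (x : S) : TangentSpace (𝓡∂ n) x →L[ℝ] ℝ :=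
  mfderiv (𝓡∂ n) 𝓘(ℝ, ℝ) (fun y ↦ extChartAt (𝓡∂ n) x y 0) x

/-- The differential of the projection `ℝ × S → S`. -/
def spatialPart (p : ℝ × S) :
    TangentSpace (spacetimeModel n) p →L[ℝ] TangentSpace (𝓡∂ n) p.2 :=
  mfderiv (spacetimeModel n) (𝓡∂ n) Prod.snd p

/-- The inclusion `T_x S → T_{(t,x)} (ℝ × S)`, the differential of `y ↦ (t, y)`. -/
def ofSpatial (p : ℝ × S) :
    TangentSpace (𝓡∂ n) p.2 →L[ℝ] TangentSpace (spacetimeModel n) p :=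
  mfderiv (𝓡∂ n) (spacetimeModel n) (fun y ↦ (p.1, y)) p.2

/-- The inclusion `T_p (ℝ × S) → T_{(s,p)} ([0,1] × (ℝ × S))`, the differential of
`q ↦ (s, q)`. -/
def ofSlice (s : Icc (0 : ℝ) 1) (p : ℝ × S) :
    TangentSpace (spacetimeModel n) p →L[ℝ] TangentSpace (cylinderModel n) (s, p) :=
  mfderiv (spacetimeModel n) (cylinderModel n) (fun q ↦ (s, q)) p

/-- `N` is the outward unit normal at `p ∈ ∂(ℝ × S) = ℝ × ∂S` for the metric
`g = -β² dt² ⊕ h(t)`. -/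
structure SplitMetric.IsOutwardUnitNormal (G : SplitMetric n S) (p : ℝ × S)
    (N : TangentSpace (spacetimeModel n) p) : Prop where
  unit : G.spacetimeForm p N N = 1
  normal : ∀ w, boundaryCoord p.2 (spatialPart p w) = 0 → G.spacetimeForm p N w = 0
  outward : boundaryCoord p.2 (spatialPart p N) < 0

end Split

end

/-! ### Vector fields with constant coefficients in a chart -/

section ConstantFields

/-! Along `λ ↦ (λ, p)` the spatial point is fixed, so parallel transport is a linear ODE on the
fixed space `T_p M`. The field `∂_λ` is parallel, and the Koszul formula for constant-coefficient
fields gives `2 g_Z(∇_{∂_λ} v, x) = g₁(v, x) - g₀(v, x)` (`two_mul_cylinderForm_leviCivita`). A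
field `w(λ)` tangent to the slices is therefore parallel as soon as `2 g_λ(w', x) = g₀(w, x) - g₁(w,
x)` for all `x` (`isParallelAlong_slice`).

The equation decouples in a basis diagonalizing both metrics. If `g₀(e, ·) = a g₁(e, ·)` with `a >
0`, then `c(λ) e` solves it for `c = √(a / ((1 - λ) a + λ))`, which runs from `1` to `√a`. On
vectors tangent to `Σ`, transport is thus the positive square root of `h₁⁻¹ h₀`: for an
`h₁`-orthonormal eigenbasis, `h₁(℘ u, u) = ∑ √aᵢ h₁(eᵢ, u)²`, which is positive for `u ≠ 0`. The
normal has no `∂_t` component because `∂_t` is tangent to the boundary and orthogonal to `Σ`, so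
this applies to it; a negative multiple would contradict the sign.

The transport is the endpoint of a chosen parallel field, so its value must be shown independent of
the choice. This is done without ODE uniqueness: pairings of parallel fields are conserved
(`IsParallelAlong.val_eq`), and pairing with `∂_λ`, with the solution along `∂_t` and with those
along the `eᵢ` determines every component of the endpoint. -/

lemma lieBracketWithin_const {E : Type*} [NormedAddCommGroup E] [NormedSpace ℝ E]
    (v w : E) (s : Set E) (x : E) :
    lieBracketWithin ℝ (fun _ ↦ v) (fun _ ↦ w) s x = 0 := by
  simp [lieBracketWithin]

variable {E : Type*} [NormedAddCommGroup E] [NormedSpace ℝ E]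
  {H : Type*} [TopologicalSpace H] {I : ModelWithCorners ℝ E H}
  {M : Type*} [TopologicalSpace M] [ChartedSpace H M] [IsManifold I ∞ M]

lemma trivializationAt_tangent_snd {x₀ x : M} (hx : x ∈ (chartAt H x₀).source)
    (v : TangentSpace I x) :
    (trivializationAt E (TangentSpace I : M → Type _) x₀ ⟨x, v⟩).2 =
      mfderiv I 𝓘(ℝ, E) (extChartAt I x₀) x v := by
  have h := congr($(TangentBundle.continuousLinearMapAt_trivializationAt (𝕜 := ℝ) (I := I) hx) v)
  refine Eq.trans ?_ h
  exact congrFun (Trivialization.coe_linearMapAt_of_mem (R := ℝ)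
    (trivializationAt E (TangentSpace I : M → Type _) x₀) (by simpa using hx)).symm v

/-- At its own base point the preferred trivialization is the identity of the model space; this
allows tangent vectors to be used as coefficient vectors. -/
lemma trivializationAt_tangent_snd_self (x : M) (v : TangentSpace I x) :
    (trivializationAt E (TangentSpace I : M → Type _) x ⟨x, v⟩).2 = v := by
  rw [trivializationAt_tangent_snd (mem_chart_source H x), mfderiv_extChartAt_self]
  rfl

lemma trivializationAt_tangent_symm_self (x : M) (v : E) :
    (trivializationAt E (TangentSpace I : M → Type _) x).symm x v = v := by
  have h := Trivialization.symm_apply_apply_mk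
    (trivializationAt E (TangentSpace I : M → Type _) x) (b := x)
    (mem_baseSet_trivializationAt E (TangentSpace I : M → Type _) x) v
  have h' := trivializationAt_tangent_snd_self x (show TangentSpace I x from v)
  exact (congrArg _ h'.symm).trans h

lemma extend_tangent_eq_symmL {x y : M} (hy : y ∈ (chartAt H x).source) (v : TangentSpace I x) :
    FiberBundle.extend E v y =
      (trivializationAt E (TangentSpace I : M → Type _) x).symmL ℝ y v := by
  have h : ∀ w : E, (trivializationAt E (TangentSpace I : M → Type _) x).symm y w =
      (trivializationAt E (TangentSpace I : M → Type _) x).symmL ℝ y w :=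
    fun w ↦ (Trivialization.symmL_apply (R := ℝ) _ (by simpa using hy) w).symm
  exact (h _).trans (congrArg _ (trivializationAt_tangent_snd_self x v))

lemma mfderiv_extChartAt_extend {x₀ x : M} (hx : x ∈ (chartAt H x₀).source)
    (v : TangentSpace I x₀) :
    mfderiv I 𝓘(ℝ, E) (extChartAt I x₀) x (extend E v x) = v := by
  rw [extend_tangent_eq_symmL hx]
  exact congr($(TangentBundle.continuousLinearMapAt_trivializationAt (𝕜 := ℝ) (I := I) hx)
    _).symm.trans (Trivialization.continuousLinearMapAt_symmL _ (by simpa using hx) _)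

/-- The chart differential is invertible, so a constant-coefficient field is recognised by its image
under it. -/
lemma eq_extend_of_mfderiv_extChartAt {x₀ x : M} (hx : x ∈ (chartAt H x₀).source)
    {v : TangentSpace I x₀} {w : TangentSpace I x}
    (h : mfderiv I 𝓘(ℝ, E) (extChartAt I x₀) x w = v) : w = extend E v x := by
  have hi := (isInvertible_mfderiv_extChartAt (I := I) (x := x₀) (y := x) (by simpa using hx))
  exact hi.injective (h.trans (mfderiv_extChartAt_extend hx v).symm)

lemma extend_tangent_zero {x₀ x : M} (hx : x ∈ (chartAt H x₀).source) :
    extend E (0 : TangentSpace I x₀) x = 0 := by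
  rw [extend_tangent_eq_symmL hx]
  exact map_zero ((trivializationAt E (TangentSpace I : M → Type _) x₀).symmL ℝ x)

/-- Pulled back to the model space both fields are constant near the point, within the range of the
model. This removes the bracket terms from the Koszul formula. -/
lemma mlieBracket_extend (x : M) (v w : TangentSpace I x) :
    mlieBracket I (extend E v) (extend E w) x = 0 := by
  have key : ∀ v : TangentSpace I x,
      mpullbackWithin 𝓘(ℝ, E) I (extChartAt I x).symm (extend E v) (range I)
        =ᶠ[𝓝[range I] (extChartAt I x x)] fun _ ↦ v := by
    intro v
    filter_upwards [extChartAt_target_mem_nhdsWithin (I := I) x] with y hy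
    have hs : (extChartAt I x).symm y ∈ (chartAt H x).source := by
      simpa using (extChartAt I x).map_target hy
    rw [mpullbackWithin_apply]
    have hi := isInvertible_mfderivWithin_extChartAt_symm (I := I) hy
    apply hi.injective
    rw [hi.self_apply_inverse]
    have h := TangentBundle.symmL_trivializationAt (𝕜 := ℝ) (I := I) hs
    rw [(extChartAt I x).right_inv hy] at h
    rw [extend_tangent_eq_symmL hs]
    exact congr($h v)
  have hx : (extChartAt I x) x ∈ range I := mem_range_self _
  rw [← mlieBracketWithin_univ, mlieBracketWithin_apply, preimage_univ, univ_inter,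
    Filter.EventuallyEq.lieBracketWithin_vectorField_eq_of_mem (key v) (key w) hx]
  have h0 := lieBracketWithin_const (E := E) v w (range I) (extChartAt I x x)
  exact (congrArg _ h0).trans (map_zero _)

end ConstantFields

/-! ### Constant-coefficient fields on a product -/

section Prod

variable {E : Type*} [NormedAddCommGroup E] [NormedSpace ℝ E]
  {H : Type*} [TopologicalSpace H] {I : ModelWithCorners ℝ E H}
  {M : Type*} [TopologicalSpace M] [ChartedSpace H M] [IsManifold I ∞ M]
  {E' : Type*} [NormedAddCommGroup E'] [NormedSpace ℝ E']
  {H' : Type*} [TopologicalSpace H'] {I' : ModelWithCorners ℝ E' H'}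
  {M' : Type*} [TopologicalSpace M'] [ChartedSpace H' M'] [IsManifold I' ∞ M']

/-- The preferred chart of a product is the product of the preferred charts, so its differential
splits. -/
lemma extend_tangent_prod {z₀ z : M × M'} (hz : z ∈ (chartAt (ModelProd H H') z₀).source)
    (v : TangentSpace (I.prod I') z₀) :
    extend (E × E') v z =
      (extend E (x := z₀.1) (E := (TangentSpace I : M → Type _)) v.1 z.1,
       extend E' (x := z₀.2) (E := (TangentSpace I' : M' → Type _)) v.2 z.2) := by
  have hz' : z.1 ∈ (chartAt H z₀.1).source ∧ z.2 ∈ (chartAt H' z₀.2).source := by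
    simpa using! hz
  refine (eq_extend_of_mfderiv_extChartAt (E := E × E') (I := I.prod I') hz ?_).symm
  have h : mfderiv (I.prod I') 𝓘(ℝ, E × E') (extChartAt (I.prod I') z₀) z =
      (mfderiv I 𝓘(ℝ, E) (extChartAt I z₀.1) z.1).prodMap
        (mfderiv I' 𝓘(ℝ, E') (extChartAt I' z₀.2) z.2) := by
    rw [extChartAt_prod, ← mfderiv_prodMap (mdifferentiableAt_extChartAt hz'.1)
      (mdifferentiableAt_extChartAt hz'.2)]
    rw [modelWithCornersSelf_prod, ← chartedSpaceSelf_prod]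
    rfl
  refine congr($h _).trans ?_
  exact Prod.ext (mfderiv_extChartAt_extend hz'.1 _) (mfderiv_extChartAt_extend hz'.2 _)

end Prod

/-! ### The two charts of the unit interval -/

section Interval

lemma mfderiv_subtypeVal_Icc_injective (s : Icc (0 : ℝ) 1) :
    Function.Injective (mfderiv (𝓡∂ 1) 𝓘(ℝ, ℝ) (Subtype.val : Icc (0 : ℝ) 1 → ℝ) s) := by
  have hs : Function.Surjective
      (mfderiv (𝓡∂ 1) 𝓘(ℝ, ℝ) (Subtype.val : Icc (0 : ℝ) 1 → ℝ) s) := fun c ↦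
    ⟨(show ℝ from c) • (1 : TangentSpace (𝓡∂ 1) s), by
      rw [map_smul, mfderiv_subtypeVal_Icc_one]
      exact mul_one (show ℝ from c)⟩
  let L : EuclideanSpace ℝ (Fin 1) →L[ℝ] ℝ := mfderiv (𝓡∂ 1) 𝓘(ℝ, ℝ) Subtype.val s
  exact (LinearMap.injective_iff_surjective_of_finrank_eq_finrank (f := L.toLinearMap)
    (by simp)).2 hs

/-- The left chart is `r ↦ r` and the right chart, used only at `s = 1`, is `r ↦ 1 - r`; both have
affine inverses. -/
lemma exists_affine_extChartAt_Icc (s : Icc (0 : ℝ) 1) :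
    ∃ (L : EuclideanSpace ℝ (Fin 1) →L[ℝ] ℝ) (c : ℝ), ∀ r ∈ (chartAt (EuclideanHalfSpace 1) s).source,
      (r : ℝ) = L (extChartAt (𝓡∂ 1) s r) + c := by
  by_cases h : (s : ℝ) < 1
  · refine ⟨EuclideanSpace.proj 0, 0, fun r hr ↦ ?_⟩
    simp [extChartAt, h, IccLeftChart, modelWithCornersEuclideanHalfSpace]
  · refine ⟨-EuclideanSpace.proj 0, 1, fun r hr ↦ ?_⟩
    simp [extChartAt, h, IccRightChart, modelWithCornersEuclideanHalfSpace]

/-- Since the charts are affine, `dλ` is constant on constant-coefficient fields; hence `dλ²`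
contributes no derivative to the Koszul formula. -/
lemma mfderiv_subtypeVal_Icc_extend {s r : Icc (0 : ℝ) 1}
    (hr : r ∈ (chartAt (EuclideanHalfSpace 1) s).source) (v : TangentSpace (𝓡∂ 1) s) :
    mfderiv (𝓡∂ 1) 𝓘(ℝ, ℝ) (Subtype.val : Icc (0 : ℝ) 1 → ℝ) r
        (extend (EuclideanSpace ℝ (Fin 1)) v r) =
      mfderiv (𝓡∂ 1) 𝓘(ℝ, ℝ) (Subtype.val : Icc (0 : ℝ) 1 → ℝ) s v := by
  obtain ⟨L, c, hL⟩ := exists_affine_extChartAt_Icc s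
  have key : ∀ r ∈ (chartAt (EuclideanHalfSpace 1) s).source,
      mfderiv (𝓡∂ 1) 𝓘(ℝ, ℝ) (Subtype.val : Icc (0 : ℝ) 1 → ℝ) r
        (extend (EuclideanSpace ℝ (Fin 1)) v r) = L v := by
    intro r hr
    have he : (Subtype.val : Icc (0 : ℝ) 1 → ℝ) =ᶠ[𝓝 r]
        (fun x ↦ L x + c) ∘ extChartAt (𝓡∂ 1) s := by
      filter_upwards [(chartAt (EuclideanHalfSpace 1) s).open_source.mem_nhds hr] with t ht
      exact hL t ht
    have hA : HasMFDerivAt 𝓘(ℝ, EuclideanSpace ℝ (Fin 1)) 𝓘(ℝ, ℝ) (fun x ↦ L x + c)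
        (extChartAt (𝓡∂ 1) s r) L :=
      (L.hasFDerivAt.add_const c).hasMFDerivAt
    rw [he.mfderiv_eq, (hA.comp r (mdifferentiableAt_extChartAt hr).hasMFDerivAt).mfderiv]
    exact congrArg L (mfderiv_extChartAt_extend hr v)
  have h := key s (mem_chart_source _ s)
  rw [extend_apply_self] at h
  exact (key r hr).trans h.symm

lemma extend_one_Icc {s r : Icc (0 : ℝ) 1}
    (hr : r ∈ (chartAt (EuclideanHalfSpace 1) s).source) :
    extend (EuclideanSpace ℝ (Fin 1)) (1 : TangentSpace (𝓡∂ 1) s) r = 1 := by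
  apply mfderiv_subtypeVal_Icc_injective r
  rw [mfderiv_subtypeVal_Icc_extend hr, mfderiv_subtypeVal_Icc_one, mfderiv_subtypeVal_Icc_one]
  rfl

end Interval

/-! ### Metric compatibility along curves -/

noncomputable section
section Along

variable {E : Type*} [NormedAddCommGroup E] [NormedSpace ℝ E]
  {H : Type*} [TopologicalSpace H] {I : ModelWithCorners ℝ E H}
  {M : Type*} [TopologicalSpace M] [ChartedSpace H M] [IsManifold I ∞ M]
  {g : PseudoRiemannianMetric I M}

omit [IsManifold I ∞ M] in
-- The Leibniz rule for evaluation; used twice in succession, it differentiates a bilinear form in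
-- two moving arguments.
lemma HasMFDerivAt.exists_clm_apply {F G : Type*} [NormedAddCommGroup F] [NormedSpace ℝ F]
    [NormedAddCommGroup G] [NormedSpace ℝ G] {x : M} {φ : M → F →L[ℝ] G} {u : M → F}
    {φ' : TangentSpace I x →L[ℝ] (F →L[ℝ] G)} {u' : TangentSpace I x →L[ℝ] F}
    (hφ : HasMFDerivAt I 𝓘(ℝ, F →L[ℝ] G) φ x φ') (hu : HasMFDerivAt I 𝓘(ℝ, F) u x u') :
    ∃ D : TangentSpace I x →L[ℝ] G, HasMFDerivAt I 𝓘(ℝ, G) (fun y ↦ φ y (u y)) x D ∧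
      ∀ a, D a = φ x (u' a) + φ' a (u x) := by
  have h := (ContinuousLinearMap.fst ℝ (F →L[ℝ] G) F).hasFDerivAt.clm_apply
    ((ContinuousLinearMap.snd ℝ (F →L[ℝ] G) F).hasFDerivAt (x := (φ x, u x)))
  have hp : HasMFDerivAt I 𝓘(ℝ, (F →L[ℝ] G) × F) (fun y ↦ (φ y, u y)) x (φ'.prod u') :=
    ⟨hφ.1.prodMk hu.1, hφ.2.prodMk hu.2⟩
  exact ⟨_, h.hasMFDerivAt.comp x hp, fun a ↦ rfl⟩

namespace PseudoRiemannianMetric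

variable (g) in
/-- The matrix of the metric at `y` in the chart at `x`. -/
def inChart (x y : M) : E →L[ℝ] E →L[ℝ] ℝ :=
  inCoordinates E (TangentSpace I : M → Type _) (E →L[ℝ] ℝ)
    (fun y : M ↦ TangentSpace I y →L[ℝ] ℝ) x y x y (g.val y)

lemma mdifferentiableAt_inChart (x : M) :
    MDifferentiableAt I 𝓘(ℝ, E →L[ℝ] E →L[ℝ] ℝ) (g.inChart x) x :=
  (((contMDiffAt_hom_bundle _).1 (g.isSmooth x)).2).mdifferentiableAt (by simp)

lemma inChart_apply {x y : M} (hy : y ∈ (chartAt H x).source) (v w : E) :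
    g.inChart x y v w = g.val y
      ((trivializationAt E (TangentSpace I : M → Type _) x).symm y v)
      ((trivializationAt E (TangentSpace I : M → Type _) x).symm y w) := by
  have hy' : y ∈ (trivializationAt E (TangentSpace I : M → Type _) x).baseSet := by simpa using hy
  rw [inChart, inCoordinates_apply_eq₂ hy' hy' (by simp)]
  simp

lemma inChart_self (x : M) (v w : TangentSpace I x) : g.inChart x x v w = g.val x v w := by
  refine (inChart_apply (E := E) (mem_chart_source H x) v w).trans ?_
  exact congrArg₂ (fun a b ↦ g.val x a b) (trivializationAt_tangent_symm_self (E := E) x v)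
    (trivializationAt_tangent_symm_self (E := E) x w)

/-- With constant coefficients only the matrix of the metric varies. -/
lemma mvfderiv_val_extend (x : M) (a v w : TangentSpace I x) :
    mvfderiv I (fun y ↦ g.val y (extend E v y) (extend E w y)) x a =
      (show E →L[ℝ] E →L[ℝ] ℝ from mfderiv I 𝓘(ℝ, E →L[ℝ] E →L[ℝ] ℝ) (g.inChart x) x a) v w := by
  have he : (fun y ↦ g.val y (extend E v y) (extend E w y)) =ᶠ[𝓝 x]
      fun y ↦ (show E →L[ℝ] E →L[ℝ] ℝ from g.inChart x y) v w := by
    filter_upwards [(chartAt H x).open_source.mem_nhds (mem_chart_source H x)] with y hy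
    refine (Eq.trans ?_ (inChart_apply (E := E) hy v w).symm)
    have : ∀ v : TangentSpace I x, extend E v y =
        (trivializationAt E (TangentSpace I : M → Type _) x).symm y v := fun v ↦
      congrArg _ (trivializationAt_tangent_snd_self x v)
    rw [this, this]
  obtain ⟨D, hD, hD'⟩ := HasMFDerivAt.exists_clm_apply (F := E) (G := E →L[ℝ] ℝ)
    (mdifferentiableAt_inChart (g := g) x).hasMFDerivAt (hasMFDerivAt_const (I := I) (I' := 𝓘(ℝ, E)) (M' := E) v x)
  obtain ⟨D₂, hD₂, hD₂'⟩ := HasMFDerivAt.exists_clm_apply (F := E) (G := ℝ) hD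
    (hasMFDerivAt_const (I := I) (I' := 𝓘(ℝ, E)) (M' := E) w x)
  refine congr($((hD₂.congr_of_eventuallyEq he).mfderiv) a).trans ((hD₂' a).trans ?_)
  rw [hD']
  exact (congrArg (· + _) (map_zero _)).trans ((zero_add _).trans
    (congrArg (fun L : E →L[ℝ] ℝ ↦ L w) ((congrArg (· + _) (map_zero _)).trans (zero_add _))))

end PseudoRiemannianMetric

variable [FiniteDimensional ℝ E] [CompleteSpace E]
  {cov : CovariantDerivative I E (TangentSpace I : M → Type _)}

/-- The Koszul formula for vector fields with constant coefficients in a chart. -/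
lemma IsLeviCivita.two_mul_val_extend (h : IsLeviCivita g cov) (x : M)
    (a v w : TangentSpace I x) :
    2 * g.val x (cov (extend E v) x a) w =
      mvfderiv I (fun y ↦ g.val y (extend E v y) (extend E w y)) x a
      + mvfderiv I (fun y ↦ g.val y (extend E a y) (extend E w y)) x v
      - mvfderiv I (fun y ↦ g.val y (extend E a y) (extend E v y)) x w := by
  have hm := fun v : TangentSpace I x ↦
    mdifferentiableAt_extend I E (V := (TangentSpace I : M → Type _)) v
  have h0 := h.two_mul_val (hm a) (hm v) (hm w)
  simpa [PseudoRiemannianMetric.koszul, mlieBracket_extend] using h0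

variable {γ : Icc (0 : ℝ) 1 → M}

/-- The Levi-Civita connection is metric along curves. -/
lemma IsLeviCivita.mfderiv_val_along (h : IsLeviCivita g cov)
    {V W : ∀ s, TangentSpace I (γ s)}
    (hV : MDifferentiable (𝓡∂ 1) (I.prod 𝓘(ℝ, E)) (fun s ↦ (⟨γ s, V s⟩ : TangentBundle I M)))
    (hW : MDifferentiable (𝓡∂ 1) (I.prod 𝓘(ℝ, E)) (fun s ↦ (⟨γ s, W s⟩ : TangentBundle I M)))
    (s : Icc (0 : ℝ) 1) :
    ∃ D : TangentSpace (𝓡∂ 1) s →L[ℝ] ℝ,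
      HasMFDerivAt (𝓡∂ 1) 𝓘(ℝ, ℝ) (fun r ↦ g.val (γ r) (V r) (W r)) s D ∧
      D 1 = g.val (γ s) (covDerivAlong cov V s) (W s)
        + g.val (γ s) (V s) (covDerivAlong cov W s) := by
  let e := trivializationAt E (TangentSpace I : M → Type _) (γ s)
  obtain ⟨hγ, hc⟩ := (mdifferentiableAt_totalSpace _ _).1 (hV s)
  have hd := ((mdifferentiableAt_totalSpace _ _).1 (hW s)).2
  let c : Icc (0 : ℝ) 1 → E := fun r ↦ (e ⟨γ r, V r⟩).2
  let d : Icc (0 : ℝ) 1 → E := fun r ↦ (e ⟨γ r, W r⟩).2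
  have hcs : c s = V s := trivializationAt_tangent_snd_self _ _
  have hds : d s = W s := trivializationAt_tangent_snd_self _ _
  have hB := (PseudoRiemannianMetric.mdifferentiableAt_inChart (g := g) (γ s)).hasMFDerivAt.comp s
    hγ.hasMFDerivAt
  set B' : TangentSpace (𝓡∂ 1) s →L[ℝ] (E →L[ℝ] E →L[ℝ] ℝ) :=
    (mfderiv I 𝓘(ℝ, E →L[ℝ] E →L[ℝ] ℝ) (g.inChart (γ s)) (γ s)) ∘L (mfderiv (𝓡∂ 1) I γ s) with hB'
  let c' : TangentSpace (𝓡∂ 1) s →L[ℝ] E := mfderiv (𝓡∂ 1) 𝓘(ℝ, E) c s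
  let d' : TangentSpace (𝓡∂ 1) s →L[ℝ] E := mfderiv (𝓡∂ 1) 𝓘(ℝ, E) d s
  obtain ⟨D₁, hD₁, hD₁'⟩ := HasMFDerivAt.exists_clm_apply (F := E) (G := E →L[ℝ] ℝ) hB
    (show MDifferentiableAt (𝓡∂ 1) 𝓘(ℝ, E) c s from hc).hasMFDerivAt
  obtain ⟨D, hF, hD'⟩ := HasMFDerivAt.exists_clm_apply (F := E) (G := ℝ) hD₁
    (show MDifferentiableAt (𝓡∂ 1) 𝓘(ℝ, E) d s from hd).hasMFDerivAt
  have he : (fun r ↦ g.val (γ r) (V r) (W r)) =ᶠ[𝓝 s]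
      (fun r ↦ g.inChart (γ s) (γ r) (c r) (d r)) := by
    filter_upwards [hγ.continuousAt.preimage_mem_nhds
      ((chartAt H (γ s)).open_source.mem_nhds (mem_chart_source H (γ s)))] with r hr
    have hr' : γ r ∈ e.baseSet := by simpa [e] using hr
    rw [PseudoRiemannianMetric.inChart_apply hr]
    simp only [c, d]
    rw [e.symm_apply_apply_mk hr', e.symm_apply_apply_mk hr']
  refine ⟨_, hF.congr_of_eventuallyEq he, ?_⟩
  have hm := h.metric (γ s) (velocity γ s) (extend E (V s)) (extend E (W s))
    (mdifferentiableAt_extend I E (V := (TangentSpace I : M → Type _)) _)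
    (mdifferentiableAt_extend I E (V := (TangentSpace I : M → Type _)) _)
  rw [PseudoRiemannianMetric.mvfderiv_val_extend, extend_apply_self, extend_apply_self] at hm
  let C : TangentSpace I (γ s) := c' 1
  let D' : TangentSpace I (γ s) := d' 1
  have hVs : covDerivAlong cov V s = C + cov (extend E (V s)) (γ s) (velocity γ s) :=
    congrArg (· + _) (trivializationAt_tangent_symm_self (γ s) (c' 1))
  have hWs : covDerivAlong cov W s = D' + cov (extend E (W s)) (γ s) (velocity γ s) :=
    congrArg (· + _) (trivializationAt_tangent_symm_self (γ s) (d' 1))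
  have e1 : g.inChart (γ s) (γ s) (c' 1) (W s) = g.val (γ s) C (W s) :=
    PseudoRiemannianMetric.inChart_self (γ s) C (W s)
  have e2 : g.inChart (γ s) (γ s) (V s) (d' 1) = g.val (γ s) (V s) D' :=
    PseudoRiemannianMetric.inChart_self (γ s) (V s) D'
  rw [hVs, hWs, map_add, map_add, add_apply]
  have hval : g.inChart (γ s) (γ s) (c s) (d' 1) +
      (g.inChart (γ s) (γ s) (c' 1) (d s) + (B' 1) (c s) (d s)) =
      g.val (γ s) C (W s) +
        g.val (γ s) (cov (extend E (V s)) (γ s) (velocity γ s)) (W s) +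
      (g.val (γ s) (V s) D' +
        g.val (γ s) (V s) (cov (extend E (W s)) (γ s) (velocity γ s))) := by
    -- Compatibility of the connection, applied to the constant-coefficient extensions of `V s` and
    -- `W s`, turns the derivative of the metric matrix along the velocity into the two connection
    -- terms.
    have hm' : (B' 1) (c s) (d s) =
        g.val (γ s) (cov (extend E (V s)) (γ s) (velocity γ s)) (W s) +
        g.val (γ s) (V s) (cov (extend E (W s)) (γ s) (velocity γ s)) := by
      rw [hcs, hds]; exact hm
    rw [hm', hcs, hds]
    linarith
  refine (hD' 1).trans ?_
  rw [hD₁']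
  exact hval

/-- Composition with `projIcc` reduces this to a function on a real interval with zero derivative.
-/
lemma eq_of_mfderiv_Icc_eq_zero {f : Icc (0 : ℝ) 1 → ℝ}
    (hf : ∀ s, ∃ D : TangentSpace (𝓡∂ 1) s →L[ℝ] ℝ,
      HasMFDerivAt (𝓡∂ 1) 𝓘(ℝ, ℝ) f s D ∧ D 1 = 0) : f 0 = f 1 := by
  have hd : ∀ t ∈ Icc (0 : ℝ) 1,
      HasDerivWithinAt (f ∘ Set.projIcc (0 : ℝ) 1 zero_le_one) 0 (Icc 0 1) t := by
    intro t ht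
    obtain ⟨D, hD, hD1⟩ := hf (Set.projIcc (0 : ℝ) 1 zero_le_one t)
    have hp := (contMDiffOn_projIcc (x := (0 : ℝ)) (y := 1) (n := 1) t ht).mdifferentiableWithinAt
      (by simp)
    have h := (hD.comp_hasMFDerivWithinAt t hp.hasMFDerivWithinAt).hasFDerivWithinAt
    refine HasFDerivWithinAt.congr_fderiv h ?_
    ext
    exact (congrArg D (mfderivWithin_projIcc_one ht)).trans (hD1.trans (by rw [toSpanSingleton_zero]; rfl))
  have := constant_of_derivWithin_zero (f := f ∘ Set.projIcc (0 : ℝ) 1 zero_le_one)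
    (fun t ht ↦ (hd t ht).differentiableWithinAt)
    (fun t ht ↦ (hd t (Ico_subset_Icc_self ht)).derivWithin
      (uniqueDiffOn_Icc zero_lt_one t (Ico_subset_Icc_self ht))) 1 (by simp)
  simpa using this.symm

/-- Both terms of the product rule vanish. This conservation law stands in for uniqueness of
parallel fields. -/
lemma IsParallelAlong.val_eq (h : IsLeviCivita g cov) {V W : ∀ s, TangentSpace I (γ s)}
    (hV : IsParallelAlong cov γ V) (hW : IsParallelAlong cov γ W) :
    g.val (γ 0) (V 0) (W 0) = g.val (γ 1) (V 1) (W 1) := by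
  refine eq_of_mfderiv_Icc_eq_zero (f := fun r ↦ g.val (γ r) (V r) (W r)) fun s ↦ ?_
  obtain ⟨D, hD, hD1⟩ := h.mfderiv_val_along hV.mdifferentiable hW.mdifferentiable s
  refine ⟨D, hD, hD1.trans ?_⟩
  rw [hV.covDerivAlong_eq_zero, hW.covDerivAlong_eq_zero]
  simp

end Along
end

/-! ### Covariant derivatives along a curve in coordinates -/

noncomputable section
section Coefficients

variable {E : Type*} [NormedAddCommGroup E] [NormedSpace ℝ E]
  {H : Type*} [TopologicalSpace H] {I : ModelWithCorners ℝ E H}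
  {M : Type*} [TopologicalSpace M] [ChartedSpace H M] [IsManifold I ∞ M]
  {cov : CovariantDerivative I E (TangentSpace I : M → Type _)}
  {γ : Icc (0 : ℝ) 1 → M}

/-- The covariant derivative along a curve of a field with known coefficients in a chart. -/
lemma covDerivAlong_of_eventuallyEq_extend {s : Icc (0 : ℝ) 1}
    (hγ : MDifferentiableAt (𝓡∂ 1) I γ s) {V : ∀ s, TangentSpace I (γ s)}
    {c : Icc (0 : ℝ) 1 → E} {c' : TangentSpace (𝓡∂ 1) s →L[ℝ] E}
    (hc : HasMFDerivAt (𝓡∂ 1) 𝓘(ℝ, E) c s c')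
    (hV : ∀ᶠ r in 𝓝 s, V r = extend E (show TangentSpace I (γ s) from c r) (γ r)) :
    MDifferentiableAt (𝓡∂ 1) (I.prod 𝓘(ℝ, E)) (fun s ↦ (⟨γ s, V s⟩ : TangentBundle I M)) s ∧
      ∃ a : TangentSpace I (γ s), a = c' 1 ∧
        covDerivAlong cov V s = a + cov (extend E (V s)) (γ s) (velocity γ s) := by
  have he : (fun r ↦ (trivializationAt E (TangentSpace I : M → Type _) (γ s) ⟨γ r, V r⟩).2)
      =ᶠ[𝓝 s] c := by
    filter_upwards [hV, hγ.continuousAt.preimage_mem_nhds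
      ((chartAt H (γ s)).open_source.mem_nhds (mem_chart_source H (γ s)))] with r hr hr'
    rw [trivializationAt_tangent_snd hr', hr]
    exact mfderiv_extChartAt_extend hr' (c r)
  have hm := hc.congr_of_eventuallyEq he
  refine ⟨(mdifferentiableAt_totalSpace _ _).2 ⟨hγ, hm.mdifferentiableAt⟩, c' 1, rfl, ?_⟩
  have h := trivializationAt_tangent_symm_self (I := I) (γ s) (c' 1)
  refine congrArg (· + _) (Eq.trans ?_ h)
  rw [hm.mfderiv]
  rfl

end Coefficients

/-! ### The Levi-Civita connection of the cylinder metric -/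

section Cylinder

variable {n : ℕ} [NeZero n]
  {S : Type*} [TopologicalSpace S] [ChartedSpace (EuclideanHalfSpace n) S]

lemma ofSpatial_apply (p : ℝ × S) (u : EuclideanSpace ℝ (Fin n)) :
    ofSpatial p u = ((0 : ℝ), u) := by
  have h : HasMFDerivAt (𝓡∂ n) (spacetimeModel n) (fun y : S ↦ (p.1, y)) p.2
      (ContinuousLinearMap.prod 0 (ContinuousLinearMap.id ℝ (TangentSpace (𝓡∂ n) p.2))) :=
    (hasMFDerivAt_const p.1 p.2).prodMk (hasMFDerivAt_id p.2)
  rw [ofSpatial, h.mfderiv]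
  rfl

lemma spatialPart_apply (p : ℝ × S) (v : ℝ × EuclideanSpace ℝ (Fin n)) :
    spatialPart p v = v.2 := by
  rw [spatialPart, mfderiv_snd]
  rfl

lemma ofSlice_apply (s : Icc (0 : ℝ) 1) (p : ℝ × S) (v : ℝ × EuclideanSpace ℝ (Fin n)) :
    ofSlice s p v = ((0 : EuclideanSpace ℝ (Fin 1)), v) := by
  have h : HasMFDerivAt (spacetimeModel n) (cylinderModel n) (fun q : ℝ × S ↦ (s, q)) p
      (ContinuousLinearMap.prod 0 (ContinuousLinearMap.id ℝ (TangentSpace (spacetimeModel n) p))) :=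
    (hasMFDerivAt_const s p).prodMk (hasMFDerivAt_id p)
  rw [ofSlice, h.mfderiv]
  rfl

lemma hasMFDerivAt_cylinderLine (p : ℝ × S) (s : Icc (0 : ℝ) 1) :
    HasMFDerivAt (𝓡∂ 1) (cylinderModel n) (fun r : Icc (0 : ℝ) 1 ↦ (r, p)) s
      (ContinuousLinearMap.prod (ContinuousLinearMap.id ℝ (TangentSpace (𝓡∂ 1) s)) 0) :=
  (hasMFDerivAt_id s).prodMk (hasMFDerivAt_const p s)

lemma velocity_cylinderLine (p : ℝ × S) (s : Icc (0 : ℝ) 1) :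
    velocity (I := cylinderModel n) (fun r : Icc (0 : ℝ) 1 ↦ (r, p)) s =
      ((1 : TangentSpace (𝓡∂ 1) s), (0 : TangentSpace (spacetimeModel n) p)) := by
  rw [velocity, (hasMFDerivAt_cylinderLine p s).mfderiv]
  rfl

variable [IsManifold (𝓡∂ n) ∞ S] (G G₀ G₁ : SplitMetric n S)

namespace SplitMetric

lemma spacetimeForm_apply (p : ℝ × S) (v w : ℝ × EuclideanSpace ℝ (Fin n)) :
    G.spacetimeForm p v w = -(G.lapse p ^ 2) * (v.1 * w.1) + G.spatial p v.2 w.2 := by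
  change -(G.lapse p ^ 2) * ContinuousLinearMap.mul ℝ ℝ
    (mfderiv (spacetimeModel n) 𝓘(ℝ, ℝ) Prod.fst p v)
    (mfderiv (spacetimeModel n) 𝓘(ℝ, ℝ) Prod.fst p w)
    + G.spatial p (mfderiv (spacetimeModel n) (𝓡∂ n) Prod.snd p v)
      (mfderiv (spacetimeModel n) (𝓡∂ n) Prod.snd p w) = _
  rw [mfderiv_fst, mfderiv_snd]
  rfl

/-- The differential of the coordinate `λ` on `[0,1]`. -/
def dIcc (s : Icc (0 : ℝ) 1) : EuclideanSpace ℝ (Fin 1) →L[ℝ] ℝ :=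
  mfderiv (𝓡∂ 1) 𝓘(ℝ, ℝ) (Subtype.val : Icc (0 : ℝ) 1 → ℝ) s

lemma cylinderForm_eq (z : Icc (0 : ℝ) 1 × (ℝ × S))
    (v w : EuclideanSpace ℝ (Fin 1) × (ℝ × EuclideanSpace ℝ (Fin n))) :
    G₀.cylinderForm G₁ z v w = dIcc z.1 v.1 * dIcc z.1 w.1
      + ((1 - (z.1 : ℝ)) * G₀.spacetimeForm z.2 v.2 w.2
        + (z.1 : ℝ) * G₁.spacetimeForm z.2 v.2 w.2) := by
  rw [spacetimeForm_apply, spacetimeForm_apply]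
  exact cylinderForm_apply G₀ G₁ z v w

/-- The metric `g_Z` on vector fields with constant coefficients in a chart. -/
lemma cylinderForm_extend {z₀ z : Icc (0 : ℝ) 1 × (ℝ × S)}
    (hz : z ∈ (chartAt (ModelProd (EuclideanHalfSpace 1)
      (ModelProd ℝ (EuclideanHalfSpace n))) z₀).source)
    (v w : EuclideanSpace ℝ (Fin 1) × (ℝ × EuclideanSpace ℝ (Fin n))) :
    G₀.cylinderForm G₁ z
        (extend (EuclideanSpace ℝ (Fin 1) × (ℝ × EuclideanSpace ℝ (Fin n)))
          (show TangentSpace (cylinderModel n) z₀ from v) z)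
        (extend (EuclideanSpace ℝ (Fin 1) × (ℝ × EuclideanSpace ℝ (Fin n)))
          (show TangentSpace (cylinderModel n) z₀ from w) z) =
      dIcc z₀.1 v.1 * dIcc z₀.1 w.1
      + ((1 - (z.1 : ℝ)) * G₀.spacetimeForm z.2
          (extend (ℝ × EuclideanSpace ℝ (Fin n))
            (show TangentSpace (spacetimeModel n) z₀.2 from v.2) z.2)
          (extend (ℝ × EuclideanSpace ℝ (Fin n))
            (show TangentSpace (spacetimeModel n) z₀.2 from w.2) z.2)
        + (z.1 : ℝ) * G₁.spacetimeForm z.2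
          (extend (ℝ × EuclideanSpace ℝ (Fin n))
            (show TangentSpace (spacetimeModel n) z₀.2 from v.2) z.2)
          (extend (ℝ × EuclideanSpace ℝ (Fin n))
            (show TangentSpace (spacetimeModel n) z₀.2 from w.2) z.2)) := by
  have hz' : z.1 ∈ (chartAt (EuclideanHalfSpace 1) z₀.1).source := by
    have : z ∈ (chartAt (EuclideanHalfSpace 1) z₀.1).source ×ˢ
      (chartAt (ModelProd ℝ (EuclideanHalfSpace n)) z₀.2).source := by simpa using! hz
    exact this.1
  have hv := extend_tangent_prod (I := 𝓡∂ 1) (I' := spacetimeModel n) hz v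
  have hw := extend_tangent_prod (I := 𝓡∂ 1) (I' := spacetimeModel n) hz w
  refine (congrArg₂ (fun a b ↦ G₀.cylinderForm G₁ z a b) hv hw).trans ?_
  refine (cylinderForm_eq G₀ G₁ z _ _).trans ?_
  refine congrArg (· + _) ?_
  exact congrArg₂ (fun a b : ℝ ↦ a * b)
    (mfderiv_subtypeVal_Icc_extend hz' (show TangentSpace (𝓡∂ 1) z₀.1 from v.1))
    (mfderiv_subtypeVal_Icc_extend hz' (show TangentSpace (𝓡∂ 1) z₀.1 from w.1))

/-- In the Koszul formula the two terms pairing with the extension of `∂_λ` are derivatives of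
locally constant functions. What is left is the `λ`-derivative of `(1 - λ) g₀ + λ g₁` on fixed
vectors. -/
lemma two_mul_cylinderForm_leviCivita (p : ℝ × S) (s : Icc (0 : ℝ) 1)
    (v w : EuclideanSpace ℝ (Fin 1) × (ℝ × EuclideanSpace ℝ (Fin n))) :
    2 * G₀.cylinderForm G₁ (s, p)
        ((G₀.cylinderMetric G₁).leviCivita
          (extend (EuclideanSpace ℝ (Fin 1) × (ℝ × EuclideanSpace ℝ (Fin n)))
            (show TangentSpace (cylinderModel n) (s, p) from v)) (s, p)
          (velocity (I := cylinderModel n) (fun r : Icc (0 : ℝ) 1 ↦ (r, p)) s)) w =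
      G₁.spacetimeForm p v.2 w.2 - G₀.spacetimeForm p v.2 w.2 := by
  have hK := (G₀.cylinderMetric G₁).isLeviCivita_leviCivita.two_mul_val_extend (s, p)
    (velocity (I := cylinderModel n) (fun r : Icc (0 : ℝ) 1 ↦ (r, p)) s) v w
  refine hK.trans ?_
  have hnhds := (chartAt (ModelProd (EuclideanHalfSpace 1)
      (ModelProd ℝ (EuclideanHalfSpace n))) ((s, p) : Icc (0 : ℝ) 1 × (ℝ × S))).open_source.mem_nhds
      (mem_chart_source _ _)
  -- The extension of the velocity has zero slice component throughout the chart, so only `dλ²`,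
  -- constant on these fields, survives.
  have hzero : ∀ w b : TangentSpace (cylinderModel n) ((s, p) : Icc (0 : ℝ) 1 × (ℝ × S)),
      mvfderiv (cylinderModel n) (fun y ↦ (G₀.cylinderMetric G₁).val y
        (extend (EuclideanSpace ℝ (Fin 1) × (ℝ × EuclideanSpace ℝ (Fin n)))
          (velocity (I := cylinderModel n) (fun r : Icc (0 : ℝ) 1 ↦ (r, p)) s) y)
        (extend (EuclideanSpace ℝ (Fin 1) × (ℝ × EuclideanSpace ℝ (Fin n))) w y)) (s, p) b = 0 := by
    intro w b
    have he : (fun y ↦ (G₀.cylinderMetric G₁).val y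
        (extend (EuclideanSpace ℝ (Fin 1) × (ℝ × EuclideanSpace ℝ (Fin n)))
          (velocity (I := cylinderModel n) (fun r : Icc (0 : ℝ) 1 ↦ (r, p)) s) y)
        (extend (EuclideanSpace ℝ (Fin 1) × (ℝ × EuclideanSpace ℝ (Fin n))) w y))
        =ᶠ[𝓝 ((s, p) : Icc (0 : ℝ) 1 × (ℝ × S))]
        fun _ ↦ dIcc s (1 : TangentSpace (𝓡∂ 1) s) * dIcc s w.1 := by
      filter_upwards [hnhds] with z hz
      refine (cylinderForm_extend G₀ G₁ hz
        (velocity (I := cylinderModel n) (fun r : Icc (0 : ℝ) 1 ↦ (r, p)) s) w).trans ?_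
      rw [velocity_cylinderLine]
      have hz' : z.2 ∈ (chartAt (ModelProd ℝ (EuclideanHalfSpace n)) p).source := by
        have : z ∈ (chartAt (EuclideanHalfSpace 1) s).source ×ˢ
          (chartAt (ModelProd ℝ (EuclideanHalfSpace n)) p).source := by simpa using! hz
        exact this.2
      have h0 := extend_tangent_zero (E := ℝ × EuclideanSpace ℝ (Fin n))
        (I := spacetimeModel n) hz'
      have h1 : ∀ (G : SplitMetric n S) (b : TangentSpace (spacetimeModel n) z.2),
          G.spacetimeForm z.2 (extend (ℝ × EuclideanSpace ℝ (Fin n))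
            (0 : TangentSpace (spacetimeModel n) p) z.2) b = 0 := by
        intro G b
        rw [h0, map_zero]
        rfl
      have h2 := h1 G₀ (extend (ℝ × EuclideanSpace ℝ (Fin n))
        (show TangentSpace (spacetimeModel n) p from w.2) z.2)
      have h3 := h1 G₁ (extend (ℝ × EuclideanSpace ℝ (Fin n))
        (show TangentSpace (spacetimeModel n) p from w.2) z.2)
      refine (congrArg₂ (fun a b : ℝ ↦ dIcc s (1 : TangentSpace (𝓡∂ 1) s) * dIcc s w.1 +
        ((1 - (z.1 : ℝ)) * a + (z.1 : ℝ) * b)) h2 h3).trans ?_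
      simp
    have hm := (hasMFDerivAt_const (I := cylinderModel n) (I' := 𝓘(ℝ, ℝ))
      (dIcc s (1 : TangentSpace (𝓡∂ 1) s) * dIcc s w.1)
      ((s, p) : Icc (0 : ℝ) 1 × (ℝ × S))).congr_of_eventuallyEq he
    exact congr($(hm.mfderiv) b)
  have hsum : ∀ {x y z t : ℝ}, y = 0 → z = 0 → x = t → x + y - z = t := by
    rintro x y z t rfl rfl rfl
    ring
  refine hsum (hzero w v) (hzero v w) ?_
  have hm := fun v : TangentSpace (cylinderModel n) ((s, p) : Icc (0 : ℝ) 1 × (ℝ × S)) ↦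
    mdifferentiableAt_extend (cylinderModel n)
      (EuclideanSpace ℝ (Fin 1) × (ℝ × EuclideanSpace ℝ (Fin n)))
      (V := (TangentSpace (cylinderModel n) : Icc (0 : ℝ) 1 × (ℝ × S) → Type _)) v
  -- The derivative in the direction of the velocity is computed by restriction to the curve, where
  -- the pairing is affine in `λ` with slope `b - a`.
  have hF := ((G₀.cylinderMetric G₁).mdiffAt_pair (hm v) (hm w)).hasMFDerivAt.comp s
    (hasMFDerivAt_cylinderLine (n := n) p s)
  set a := G₀.spacetimeForm p v.2 w.2
  set b := G₁.spacetimeForm p v.2 w.2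
  have he : (fun y ↦ (G₀.cylinderMetric G₁).val y
        (extend (EuclideanSpace ℝ (Fin 1) × (ℝ × EuclideanSpace ℝ (Fin n)))
          (show TangentSpace (cylinderModel n) (s, p) from v) y)
        (extend (EuclideanSpace ℝ (Fin 1) × (ℝ × EuclideanSpace ℝ (Fin n)))
          (show TangentSpace (cylinderModel n) (s, p) from w) y)) ∘ 
        (fun r : Icc (0 : ℝ) 1 ↦ (r, p)) =ᶠ[𝓝 s]
      (fun t : ℝ ↦ dIcc s v.1 * dIcc s w.1 + ((1 - t) * a + t * b)) ∘ Subtype.val := by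
    filter_upwards [(hasMFDerivAt_cylinderLine (n := n) p s).continuousAt.preimage_mem_nhds hnhds] with r hr
    refine (cylinderForm_extend G₀ G₁ hr v w).trans ?_
    have hx : ∀ u : TangentSpace (spacetimeModel n) p,
        extend (ℝ × EuclideanSpace ℝ (Fin n)) u p = u := fun u ↦ extend_apply_self _ _
    exact congrArg₂ (fun a b ↦ dIcc s v.1 * dIcc s w.1 +
      ((1 - (r : ℝ)) * G₀.spacetimeForm p a b + (r : ℝ) * G₁.spacetimeForm p a b)) (hx v.2) (hx w.2)
  have hA : HasDerivAt (fun t : ℝ ↦ dIcc s v.1 * dIcc s w.1 + ((1 - t) * a + t * b))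
      (b - a) (s : ℝ) := by
    have h1 := (((hasDerivAt_id (s : ℝ)).const_sub 1).mul_const a).add
      ((hasDerivAt_id (s : ℝ)).mul_const b)
    convert! h1.const_add (dIcc s v.1 * dIcc s w.1) using 1
    ring
  have hA' := (hA.hasFDerivAt.hasMFDerivAt.comp s
    ((contMDiff_subtypeVal_Icc (n := 1) s).mdifferentiableAt (by simp)).hasMFDerivAt).congr_of_eventuallyEq he
  have hu := congr($(hasMFDerivAt_unique hF hA') 1)
  rw [velocity_cylinderLine]
  refine hu.trans ?_
  have h1 : mfderiv (𝓡∂ 1) 𝓘(ℝ, ℝ) (Subtype.val : Icc (0 : ℝ) 1 → ℝ) s 1 = (1 : ℝ) :=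
    mfderiv_subtypeVal_Icc_one s
  refine (congrArg (ContinuousLinearMap.toSpanSingleton ℝ (b - a)) h1).trans ?_
  simp

end SplitMetric
end Cylinder
end

/-! ### Simultaneous diagonalization -/

noncomputable section
section Diagonalization

/-- Two inner products on a finite-dimensional space are simultaneously diagonalizable. -/
lemma exists_simultaneous_diagonalization {V : Type*} [AddCommGroup V] [Module ℝ V]
    [FiniteDimensional ℝ V] (A B : V →ₗ[ℝ] V →ₗ[ℝ] ℝ)
    (hA : ∀ v w, A v w = A w v) (hA0 : ∀ v, v ≠ 0 → 0 < A v v)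
    (hB : ∀ v w, B v w = B w v) (hB0 : ∀ v, v ≠ 0 → 0 < B v v) :
    ∃ (a : Fin (Module.finrank ℝ V) → ℝ) (e : Fin (Module.finrank ℝ V) → V),
      (∀ i, 0 < a i) ∧ (∀ i w, A (e i) w = a i * B (e i) w) ∧
      ∀ v, ∑ i, B (e i) v • e i = v := by
  have hBnn : ∀ v, 0 ≤ B v v := fun v ↦ by
    rcases eq_or_ne v 0 with rfl | hv
    · simp
    · exact (hB0 v hv).le
  -- `B` is taken as the inner product of `V`, so that the spectral theorem applies to the operator
  -- representing `A`.
  let core : InnerProductSpace.Core ℝ V :=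
    { inner := fun v w ↦ B v w
      conj_inner_symm := fun v w ↦ by simpa using hB w v
      re_inner_nonneg := fun v ↦ by simpa using hBnn v
      add_left := fun u v w ↦ by simp
      smul_left := fun v w r ↦ by simp
      definite := fun v hv ↦ by
        by_contra h
        exact (hB0 v h).ne' hv }
  let _ : NormedAddCommGroup V := core.toNormedAddCommGroup
  let _ : InnerProductSpace ℝ V := InnerProductSpace.ofCore core.toCore
  have hin : ∀ v w : V, inner ℝ v w = B v w := fun v w ↦ rfl
  let u := stdOrthonormalBasis ℝ V
  -- `T v = ∑ A(v, uᵢ) uᵢ` represents `A` with respect to `B`; symmetry of `A` makes it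
  -- self-adjoint.
  let T : V →ₗ[ℝ] V := ∑ i, (LinearMap.toSpanSingleton ℝ V (u i)) ∘ₗ (A.flip (u i))
  have hT : ∀ v w, inner ℝ (T v) w = A v w := by
    intro v w
    conv_rhs => rw [← u.sum_repr' w]
    simp [T, sum_inner, inner_smul_left, mul_comm]
  have hTs : T.IsSymmetric := fun v w ↦ by
    rw [hT, real_inner_comm, hT, hA]
  let e := hTs.eigenvectorBasis rfl
  have he : ∀ i w, A (e i) w = hTs.eigenvalues rfl i * B (e i) w := by
    intro i w
    rw [← hT, hTs.apply_eigenvectorBasis rfl i, ← hin, inner_smul_left]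
    rfl
  refine ⟨hTs.eigenvalues rfl, e, fun i ↦ ?_, he, fun v ↦ e.sum_repr' v⟩
  have hne : e i ≠ 0 := fun h ↦ by simpa [h] using e.norm_eq_one i
  exact pos_of_mul_pos_left (he i (e i) ▸ hA0 _ hne) (hBnn _)

end Diagonalization
end

/-! ### Explicit parallel fields and conserved pairings -/

noncomputable section
section Transport

variable {n : ℕ} [NeZero n]
  {S : Type*} [TopologicalSpace S] [ChartedSpace (EuclideanHalfSpace n) S]
  [IsManifold (𝓡∂ n) ∞ S] (G G₀ G₁ : SplitMetric n S)

namespace SplitMetric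

lemma eq_zero_of_cylinderForm_eq_zero (z : Icc (0 : ℝ) 1 × (ℝ × S))
    {v : TangentSpace (cylinderModel n) z}
    (hv : ∀ w : EuclideanSpace ℝ (Fin 1) × (ℝ × EuclideanSpace ℝ (Fin n)),
      G₀.cylinderForm G₁ z v w = 0) : v = 0 :=
  G₀.cylinderForm_nondegenerate G₁ z v hv

/-- The coefficients of `∂_λ` are constant in each chart, and the right-hand side of
`two_mul_cylinderForm_leviCivita` sees only the slice component, which is zero. -/
lemma isParallelAlong_velocity (p : ℝ × S) :
    IsParallelAlong (G₀.cylinderMetric G₁).leviCivita (fun s : Icc (0 : ℝ) 1 ↦ (s, p))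
      (velocity (I := cylinderModel n) (fun s : Icc (0 : ℝ) 1 ↦ (s, p))) := by
  have key := fun s : Icc (0 : ℝ) 1 ↦ covDerivAlong_of_eventuallyEq_extend (s := s)
    (cov := (G₀.cylinderMetric G₁).leviCivita)
    (V := velocity (I := cylinderModel n) (fun s : Icc (0 : ℝ) 1 ↦ (s, p)))
    (c := fun _ ↦ (velocity (I := cylinderModel n) (fun s : Icc (0 : ℝ) 1 ↦ (s, p)) s :
      EuclideanSpace ℝ (Fin 1) × (ℝ × EuclideanSpace ℝ (Fin n))))
    (hasMFDerivAt_cylinderLine p s).mdifferentiableAt (hasMFDerivAt_const _ s) (by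
      filter_upwards [(hasMFDerivAt_cylinderLine (n := n) p s).continuousAt.preimage_mem_nhds
        ((chartAt (ModelProd (EuclideanHalfSpace 1) (ModelProd ℝ (EuclideanHalfSpace n)))
          ((s, p) : Icc (0 : ℝ) 1 × (ℝ × S))).open_source.mem_nhds (mem_chart_source _ _))]
        with r hr
      have hr' : r ∈ (chartAt (EuclideanHalfSpace 1) s).source := by
        have : ((r, p) : Icc (0 : ℝ) 1 × (ℝ × S)) ∈ (chartAt (EuclideanHalfSpace 1) s).source ×ˢ
          (chartAt (ModelProd ℝ (EuclideanHalfSpace n)) p).source := by simpa using! hr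
        exact this.1
      rw [velocity_cylinderLine, velocity_cylinderLine]
      refine Eq.trans ?_ (extend_tangent_prod (I := 𝓡∂ 1) (I' := spacetimeModel n) hr
        ((1 : TangentSpace (𝓡∂ 1) s), (0 : TangentSpace (spacetimeModel n) p))).symm
      exact Prod.ext (extend_one_Icc hr').symm (extend_apply_self (F := ℝ × EuclideanSpace ℝ (Fin n))
        (0 : TangentSpace (spacetimeModel n) p)).symm)
  refine ⟨fun s ↦ (key s).1, fun s ↦ ?_⟩
  obtain ⟨a, ha, hD⟩ := (key s).2
  have ha0 : a = 0 := ha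
  rw [hD, ha0, zero_add]
  refine eq_zero_of_cylinderForm_eq_zero G₀ G₁ _ fun w ↦ ?_
  have h := two_mul_cylinderForm_leviCivita G₀ G₁ p s
    (velocity (I := cylinderModel n) (fun s : Icc (0 : ℝ) 1 ↦ (s, p)) s) w
  have h0 : ∀ G : SplitMetric n S,
      G.spacetimeForm p (0 : TangentSpace (spacetimeModel n) p) w.2 = 0 := fun G ↦ by
    rw [map_zero]; rfl
  have h1 : (velocity (I := cylinderModel n) (fun s : Icc (0 : ℝ) 1 ↦ (s, p)) s).2 = 0 := by
    rw [velocity_cylinderLine]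
    rfl
  have h2 := h.trans ((congrArg (fun v : TangentSpace (spacetimeModel n) p ↦
    G₁.spacetimeForm p v w.2 - G₀.spacetimeForm p v w.2) h1).trans
    (congrArg₂ (fun x y : ℝ ↦ x - y) (h0 G₁) (h0 G₀)))
  rw [sub_zero] at h2
  exact (mul_eq_zero.1 h2).resolve_left two_ne_zero

/-- The parallel transport equation for fields along `λ ↦ (λ, p)` that are tangent to the slices. -/
lemma isParallelAlong_slice {p : ℝ × S} {w w' : ℝ → ℝ × EuclideanSpace ℝ (Fin n)}
    (hw : ∀ s ∈ Icc (0 : ℝ) 1, HasDerivAt w (w' s) s)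
    (hpar : ∀ s ∈ Icc (0 : ℝ) 1, ∀ x : ℝ × EuclideanSpace ℝ (Fin n),
      2 * ((1 - s) * G₀.spacetimeForm p (w' s) x + s * G₁.spacetimeForm p (w' s) x) =
        G₀.spacetimeForm p (w s) x - G₁.spacetimeForm p (w s) x) :
    IsParallelAlong (I := cylinderModel n) (G₀.cylinderMetric G₁).leviCivita
      (fun s : Icc (0 : ℝ) 1 ↦ (s, p))
      (fun s ↦ ((0 : EuclideanSpace ℝ (Fin 1)), w s)) := by
  have hval : ∀ s : Icc (0 : ℝ) 1, MDifferentiableAt (𝓡∂ 1) 𝓘(ℝ, ℝ)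
      (Subtype.val : Icc (0 : ℝ) 1 → ℝ) s := fun s ↦
    (contMDiff_subtypeVal_Icc (n := 1) s).mdifferentiableAt (by simp)
  have hc := fun s : Icc (0 : ℝ) 1 ↦ (((hasDerivAt_const (s : ℝ)
    (0 : EuclideanSpace ℝ (Fin 1))).prodMk (hw s s.2)).hasFDerivAt.hasMFDerivAt).comp s
      (hval s).hasMFDerivAt
  have key := fun s : Icc (0 : ℝ) 1 ↦ covDerivAlong_of_eventuallyEq_extend (s := s)
    (I := cylinderModel n)
    (cov := (G₀.cylinderMetric G₁).leviCivita)
    (V := fun s ↦ ((0 : EuclideanSpace ℝ (Fin 1)), w s))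
    (hasMFDerivAt_cylinderLine p s).mdifferentiableAt (hc s) (by
      filter_upwards [(hasMFDerivAt_cylinderLine (n := n) p s).continuousAt.preimage_mem_nhds
        ((chartAt (ModelProd (EuclideanHalfSpace 1) (ModelProd ℝ (EuclideanHalfSpace n)))
          ((s, p) : Icc (0 : ℝ) 1 × (ℝ × S))).open_source.mem_nhds (mem_chart_source _ _))]
        with r hr
      have hr' : r ∈ (chartAt (EuclideanHalfSpace 1) s).source := by
        have : ((r, p) : Icc (0 : ℝ) 1 × (ℝ × S)) ∈ (chartAt (EuclideanHalfSpace 1) s).source ×ˢ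
          (chartAt (ModelProd ℝ (EuclideanHalfSpace n)) p).source := by simpa using! hr
        exact this.1
      -- The slice coordinate of the curve stays at `p`, so extension in that factor changes nothing
      -- and the coefficients are `(0, w r)` themselves.
      refine Eq.trans ?_ (extend_tangent_prod (I := 𝓡∂ 1) (I' := spacetimeModel n) hr
        ((0 : TangentSpace (𝓡∂ 1) s), (show TangentSpace (spacetimeModel n) p from w r))).symm
      exact Prod.ext (extend_tangent_zero (I := 𝓡∂ 1) hr').symm
        (extend_apply_self (F := ℝ × EuclideanSpace ℝ (Fin n))
          (show TangentSpace (spacetimeModel n) p from w r)).symm)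
  refine ⟨fun s ↦ (key s).1, fun s ↦ ?_⟩
  obtain ⟨a, ha, hD⟩ := (key s).2
  have ha' : a = ((0 : EuclideanSpace ℝ (Fin 1)), w' s) := by
    refine ha.trans ?_
    have h1 : mfderiv (𝓡∂ 1) 𝓘(ℝ, ℝ) (Subtype.val : Icc (0 : ℝ) 1 → ℝ) s 1 = (1 : ℝ) :=
      mfderiv_subtypeVal_Icc_one s
    refine (congrArg (ContinuousLinearMap.toSpanSingleton ℝ
      ((0 : EuclideanSpace ℝ (Fin 1)), w' s)) h1).trans ?_
    simp
  rw [hD]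
  refine eq_zero_of_cylinderForm_eq_zero G₀ G₁ _ fun x ↦ ?_
  have h := two_mul_cylinderForm_leviCivita G₀ G₁ p s ((0 : EuclideanSpace ℝ (Fin 1)), w s) x
  have h' := cylinderForm_eq G₀ G₁ (s, p) ((0 : EuclideanSpace ℝ (Fin 1)), w' s) x
  have hs := hpar s s.2 x.2
  have hadd : ∀ a b : TangentSpace (cylinderModel n) ((s, p) : Icc (0 : ℝ) 1 × (ℝ × S)),
      G₀.cylinderForm G₁ (s, p) (a + b) x =
        G₀.cylinderForm G₁ (s, p) a x + G₀.cylinderForm G₁ (s, p) b x := fun a b ↦ by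
    rw [map_add]; rfl
  -- Paired with `x`, the coefficient derivative gives `g_λ(w', x)` and the connection gives `(g₁ -
  -- g₀)(w, x) / 2`; these cancel by `hpar`.
  refine (hadd _ _).trans ((congrArg₂ (fun a b : ℝ ↦ a + b)
    ((congrArg (fun a ↦ G₀.cylinderForm G₁ (s, p) a x) ha').trans h')
    (eq_div_of_mul_eq two_ne_zero ((mul_comm _ _).trans h))).trans ?_)
  rw [map_zero, zero_mul, zero_add]
  dsimp only
  linarith

/-- The length of the parallel field in the direction of an eigenvector of `g₀` with respect to
`g₁`, for the eigenvalue `a`. -/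
def eigenCoeff (a t : ℝ) : ℝ := √a / √((1 - t) * a + t)

lemma eigenCoeff_zero {a : ℝ} (ha : 0 < a) : eigenCoeff a 0 = 1 := by
  simp [eigenCoeff, (Real.sqrt_pos.2 ha).ne']

lemma eigenCoeff_one (a : ℝ) : eigenCoeff a 1 = √a := by
  simp [eigenCoeff]

lemma eigenDenom_pos {a t : ℝ} (ha : 0 < a) (ht : t ∈ Icc (0 : ℝ) 1) : 0 < (1 - t) * a + t := by
  rcases ht.1.eq_or_lt with rfl | h
  · simpa
  · have := mul_nonneg (sub_nonneg.2 ht.2) ha.le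
    linarith

/-- This is the scalar parallel equation `2 ((1 - t) a + t) c' = (a - 1) c`. -/
lemma hasDerivAt_eigenCoeff {a t : ℝ} (ha : 0 < a) (ht : t ∈ Icc (0 : ℝ) 1) :
    HasDerivAt (eigenCoeff a) (-(1 - a) / (2 * ((1 - t) * a + t)) * eigenCoeff a t) t := by
  have hD := eigenDenom_pos ha ht
  have h1 : HasDerivAt (fun t : ℝ ↦ (1 - t) * a + t) (1 - a) t := by
    convert! (((hasDerivAt_id t).const_sub 1).mul_const a).add (hasDerivAt_id t) using 1
    ring
  have h2 := (h1.sqrt hD.ne').fun_inv (Real.sqrt_pos.2 hD).ne'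
  have h3 := h2.const_mul (√a)
  convert! h3 using 1
  have hne := (Real.sqrt_pos.2 hD).ne'
  rw [eigenCoeff, Real.sq_sqrt hD.le]
  field_simp

/-- On an eigenvector all the forms are multiples of `g₁(eᵢ, ·)`, so the parallel equation splits
into scalar equations. No linear independence is needed. -/
lemma isParallelAlong_sum_eigen {ι : Type*} [Fintype ι] {p : ℝ × S} {a : ι → ℝ}
    (ha : ∀ i, 0 < a i) {e : ι → ℝ × EuclideanSpace ℝ (Fin n)}
    (he : ∀ i (x : ℝ × EuclideanSpace ℝ (Fin n)),
      G₀.spacetimeForm p (e i) x = a i * G₁.spacetimeForm p (e i) x) :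
    IsParallelAlong (I := cylinderModel n) (G₀.cylinderMetric G₁).leviCivita
      (fun s : Icc (0 : ℝ) 1 ↦ (s, p))
      (fun s ↦ ((0 : EuclideanSpace ℝ (Fin 1)), ∑ i, eigenCoeff (a i) s • e i)) := by
  refine isParallelAlong_slice G₀ G₁ (w := fun t ↦ ∑ i, eigenCoeff (a i) t • e i)
    (w' := fun t ↦ ∑ i, (-(1 - a i) / (2 * ((1 - t) * a i + t)) * eigenCoeff (a i) t) • e i)
    (fun t ht ↦ HasDerivAt.fun_sum fun i _ ↦ (hasDerivAt_eigenCoeff (ha i) ht).smul_const (e i))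
    fun t ht x ↦ ?_
  have hsum : ∀ (G : SplitMetric n S) (c : ι → ℝ),
      G.spacetimeForm p (∑ i, c i • e i : ℝ × EuclideanSpace ℝ (Fin n)) x =
        ∑ i, c i * G.spacetimeForm p (e i) x := by
    intro G c
    let L : ℝ × EuclideanSpace ℝ (Fin n) →L[ℝ] ℝ × EuclideanSpace ℝ (Fin n) →L[ℝ] ℝ :=
      G.spacetimeForm p
    change L (∑ i, c i • e i) x = ∑ i, c i * L (e i) x
    simp
  rw [hsum, hsum, hsum, hsum]
  simp only [Finset.mul_sum, ← Finset.sum_add_distrib, ← Finset.sum_sub_distrib]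
  refine Finset.sum_congr rfl fun i _ ↦ ?_
  have hD := (eigenDenom_pos (ha i) ht).ne'
  rw [he]
  field_simp
  ring

lemma isParallelAlong_eigen {p : ℝ × S} {a : ℝ} (ha : 0 < a)
    {e : ℝ × EuclideanSpace ℝ (Fin n)}
    (he : ∀ x : ℝ × EuclideanSpace ℝ (Fin n),
      G₀.spacetimeForm p e x = a * G₁.spacetimeForm p e x) :
    IsParallelAlong (I := cylinderModel n) (G₀.cylinderMetric G₁).leviCivita
      (fun s : Icc (0 : ℝ) 1 ↦ (s, p))
      (fun s ↦ ((0 : EuclideanSpace ℝ (Fin 1)), eigenCoeff a s • e)) := by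
  simpa using isParallelAlong_sum_eigen G₀ G₁ (ι := Unit) (fun _ ↦ ha) (fun _ ↦ he)

variable {G₀ G₁}

/-- The final value of a parallel field that starts tangent to the slice. -/
lemma IsParallelAlong.final_fst {p : ℝ × S}
    {V : ∀ s : Icc (0 : ℝ) 1, TangentSpace (cylinderModel n) ((s, p) : Icc (0 : ℝ) 1 × (ℝ × S))}
    (hV : IsParallelAlong (G₀.cylinderMetric G₁).leviCivita (fun s : Icc (0 : ℝ) 1 ↦ (s, p)) V)
    {v : ℝ × EuclideanSpace ℝ (Fin n)} (hv : V 0 = ((0 : EuclideanSpace ℝ (Fin 1)), v)) :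
    (V 1 : EuclideanSpace ℝ (Fin 1) × (ℝ × EuclideanSpace ℝ (Fin n))).1 = 0 := by
  -- The pairing with `∂_λ` is the `λ`-component; it is zero at the start and is conserved.
  have h := hV.val_eq (G₀.cylinderMetric G₁).isLeviCivita_leviCivita
    (isParallelAlong_velocity G₀ G₁ p)
  rw [hv, velocity_cylinderLine, velocity_cylinderLine] at h
  have h0 := G₀.cylinderForm_eq G₁ (0, p) ((0 : EuclideanSpace ℝ (Fin 1)), v)
    ((1 : TangentSpace (𝓡∂ 1) (0 : Icc (0 : ℝ) 1)), (0 : TangentSpace (spacetimeModel n) p))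
  have h1 := G₀.cylinderForm_eq G₁ (1, p) (V 1)
    ((1 : TangentSpace (𝓡∂ 1) (1 : Icc (0 : ℝ) 1)), (0 : TangentSpace (spacetimeModel n) p))
  have hz : ∀ (G : SplitMetric n S) (x : TangentSpace (spacetimeModel n) p),
      G.spacetimeForm p x (0 : TangentSpace (spacetimeModel n) p) = 0 := fun G x ↦ map_zero _
  have hone : dIcc 1 (1 : TangentSpace (𝓡∂ 1) (1 : Icc (0 : ℝ) 1)) = 1 :=
    mfderiv_subtypeVal_Icc_one _
  have h2 := (h0.symm.trans h).trans h1
  dsimp only at h2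
  rw [map_zero, zero_mul, zero_add] at h2
  have h3 : (1 - ((0 : Icc (0 : ℝ) 1) : ℝ)) * 0 + ((0 : Icc (0 : ℝ) 1) : ℝ) * 0 =
      dIcc 1 (V 1 : EuclideanSpace ℝ (Fin 1) × (ℝ × EuclideanSpace ℝ (Fin n))).1 * 1 +
      ((1 - ((1 : Icc (0 : ℝ) 1) : ℝ)) * 0 + ((1 : Icc (0 : ℝ) 1) : ℝ) * 0) := by
    refine Eq.trans ?_ (h2.trans ?_)
    · exact (congrArg₂ (fun x y : ℝ ↦ (1 - ((0 : Icc (0 : ℝ) 1) : ℝ)) * x +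
        ((0 : Icc (0 : ℝ) 1) : ℝ) * y) (hz G₀ v) (hz G₁ v)).symm
    · exact congrArg₂ (fun x y : ℝ ↦ x + y) (congrArg (_ * ·) hone)
        (congrArg₂ (fun x y : ℝ ↦ (1 - ((1 : Icc (0 : ℝ) 1) : ℝ)) * x +
          ((1 : Icc (0 : ℝ) 1) : ℝ) * y) (hz G₀ _) (hz G₁ _))
  have h4 : dIcc 1 (V 1 : EuclideanSpace ℝ (Fin 1) × (ℝ × EuclideanSpace ℝ (Fin n))).1 = 0 := by
    simpa using h3.symm
  exact mfderiv_subtypeVal_Icc_injective 1 (h4.trans (map_zero (dIcc 1)).symm)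

/-- Conservation of the pairing with the explicit field along `e` equates `g₀(e, v) = a g₁(e, v)` at
`λ = 0` with `√a g₁(e, q)` at `λ = 1`; then cancel `√a`. -/
lemma IsParallelAlong.final_eigen {p : ℝ × S}
    {V : ∀ s : Icc (0 : ℝ) 1, TangentSpace (cylinderModel n) ((s, p) : Icc (0 : ℝ) 1 × (ℝ × S))}
    (hV : IsParallelAlong (G₀.cylinderMetric G₁).leviCivita (fun s : Icc (0 : ℝ) 1 ↦ (s, p)) V)
    {v q : ℝ × EuclideanSpace ℝ (Fin n)} (hv : V 0 = ((0 : EuclideanSpace ℝ (Fin 1)), v))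
    (hq : V 1 = ((0 : EuclideanSpace ℝ (Fin 1)), q)) {a : ℝ} (ha : 0 < a)
    {e : ℝ × EuclideanSpace ℝ (Fin n)}
    (he : ∀ x : ℝ × EuclideanSpace ℝ (Fin n),
      G₀.spacetimeForm p e x = a * G₁.spacetimeForm p e x) :
    G₁.spacetimeForm p e q = √a * G₁.spacetimeForm p e v := by
  have h := (isParallelAlong_eigen G₀ G₁ ha he).val_eq
    (G₀.cylinderMetric G₁).isLeviCivita_leviCivita hV
  rw [hv, hq] at h
  have h0 := G₀.cylinderForm_eq G₁ (0, p)
    ((0 : EuclideanSpace ℝ (Fin 1)), eigenCoeff a (0 : Icc (0 : ℝ) 1) • e)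
    ((0 : EuclideanSpace ℝ (Fin 1)), v)
  have h1 := G₀.cylinderForm_eq G₁ (1, p)
    ((0 : EuclideanSpace ℝ (Fin 1)), eigenCoeff a (1 : Icc (0 : ℝ) 1) • e)
    ((0 : EuclideanSpace ℝ (Fin 1)), q)
  have h2 := (h0.symm.trans h).trans h1
  have hs : ∀ (G : SplitMetric n S) (c : ℝ) (x : ℝ × EuclideanSpace ℝ (Fin n)),
      G.spacetimeForm p (c • e : ℝ × EuclideanSpace ℝ (Fin n)) x =
        c * G.spacetimeForm p e x := by
    intro G c x
    let L : ℝ × EuclideanSpace ℝ (Fin n) →L[ℝ] ℝ × EuclideanSpace ℝ (Fin n) →L[ℝ] ℝ :=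
      G.spacetimeForm p
    change L (c • e) x = c * L e x
    simp
  dsimp only at h2
  rw [hs, hs, hs, hs, he] at h2
  have c0 : eigenCoeff a ((0 : Icc (0 : ℝ) 1) : ℝ) = 1 := eigenCoeff_zero ha
  have c1 : eigenCoeff a ((1 : Icc (0 : ℝ) 1) : ℝ) = √a := eigenCoeff_one a
  rw [c0, c1] at h2
  have h3 : a * G₁.spacetimeForm p e v = √a * G₁.spacetimeForm p e q := by
    simpa using h2
  have hsq : √a * √a = a := Real.mul_self_sqrt ha.le
  have hpos := Real.sqrt_pos.2 ha
  apply mul_left_cancel₀ hpos.ne'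
  rw [← h3, ← mul_assoc, hsq]

end SplitMetric
end Transport
end

/-! ### Positivity of the transport and the outward normal -/

noncomputable section
section Main

variable {n : ℕ} [NeZero n]
  {S : Type*} [TopologicalSpace S] [ChartedSpace (EuclideanHalfSpace n) S]
  [IsManifold (𝓡∂ n) ∞ S] (G : SplitMetric n S) {G₀ G₁ : SplitMetric n S}

namespace SplitMetric

/-- The spatial metric at `p` as a bilinear form on the model space. -/
def spatialLin (p : ℝ × S) :
    EuclideanSpace ℝ (Fin n) →ₗ[ℝ] EuclideanSpace ℝ (Fin n) →ₗ[ℝ] ℝ :=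
  ContinuousLinearMap.coeLM ℝ ∘ₗ (show EuclideanSpace ℝ (Fin n) →L[ℝ]
    EuclideanSpace ℝ (Fin n) →L[ℝ] ℝ from G.spatial p).toLinearMap

lemma spatialLin_apply (p : ℝ × S) (v w : EuclideanSpace ℝ (Fin n)) :
    G.spatialLin p v w = G.spatial p v w := rfl

lemma spacetimeForm_zero_fst (p : ℝ × S) (u : EuclideanSpace ℝ (Fin n))
    (x : ℝ × EuclideanSpace ℝ (Fin n)) :
    G.spacetimeForm p ((0 : ℝ), u) x = G.spatialLin p u x.2 := by
  rw [spacetimeForm_apply, spatialLin_apply]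
  simp

lemma spacetimeForm_zero_snd (p : ℝ × S) (c : ℝ) (x : ℝ × EuclideanSpace ℝ (Fin n)) :
    G.spacetimeForm p (c, (0 : EuclideanSpace ℝ (Fin n))) x = -(G.lapse p ^ 2) * (c * x.1) := by
  rw [spacetimeForm_apply]
  have h : G.spatial p (0 : EuclideanSpace ℝ (Fin n)) x.2 = 0 := by
    rw [← spatialLin_apply, map_zero]; rfl
  dsimp only
  rw [h, add_zero]

lemma spacetimeForm_symm (p : ℝ × S) (v w : ℝ × EuclideanSpace ℝ (Fin n)) :
    G.spacetimeForm p v w = G.spacetimeForm p w v := by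
  rw [spacetimeForm_apply, spacetimeForm_apply, G.spatial_symm p w.2 v.2, mul_comm v.1]

/-- Parallel transport from the slice `0` to the slice `1` preserves vectors tangent to `S`, and
it is positive for the spatial metric of the second slice. -/
theorem parallelTransport_ofSpatial (p : ℝ × S) {u : EuclideanSpace ℝ (Fin n)} (hu : u ≠ 0) :
    ∃ w : EuclideanSpace ℝ (Fin n),
      parallelTransport (I := cylinderModel n) (G₀.cylinderMetric G₁).leviCivita
        (fun s : Icc (0 : ℝ) 1 ↦ (s, p)) ((0 : EuclideanSpace ℝ (Fin 1)), ((0 : ℝ), u)) =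
          ((0 : EuclideanSpace ℝ (Fin 1)), ((0 : ℝ), w)) ∧
      0 < G₁.spatialLin p w u := by
  obtain ⟨a, e, ha, he, hsum⟩ := exists_simultaneous_diagonalization
    (G₀.spatialLin p) (G₁.spatialLin p) (G₀.spatial_symm p) (G₀.spatial_pos p)
    (G₁.spatial_symm p) (G₁.spatial_pos p)
  have he' : ∀ i (c : ℝ) (x : ℝ × EuclideanSpace ℝ (Fin n)),
      G₀.spacetimeForm p ((0 : ℝ), c • e i) x = a i * G₁.spacetimeForm p ((0 : ℝ), c • e i) x := by
    intro i c x
    rw [spacetimeForm_zero_fst, spacetimeForm_zero_fst]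
    simp only [map_smul, LinearMap.smul_apply, smul_eq_mul, he]
    ring
  have hex : ∃ V : ∀ s : Icc (0 : ℝ) 1,
      TangentSpace (cylinderModel n) ((s, p) : Icc (0 : ℝ) 1 × (ℝ × S)),
      IsParallelAlong (G₀.cylinderMetric G₁).leviCivita (fun s : Icc (0 : ℝ) 1 ↦ (s, p)) V ∧
      V 0 = ((0 : EuclideanSpace ℝ (Fin 1)), ((0 : ℝ), u)) := by
    -- The component of `u` along each `e i` is absorbed into the eigenvector, so that the unit
    -- initial coefficients reproduce `u`.
    refine ⟨_, isParallelAlong_sum_eigen G₀ G₁ ha fun i ↦ he' i (G₁.spatialLin p (e i) u), ?_⟩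
    have h0 : ∀ i, eigenCoeff (a i) ((0 : Icc (0 : ℝ) 1) : ℝ) = 1 := fun i ↦ eigenCoeff_zero (ha i)
    simp only [h0, one_smul]
    refine Prod.ext rfl ?_
    refine Prod.ext ?_ ?_
    · exact Prod.fst_sum.trans (by simp)
    · exact Prod.snd_sum.trans (hsum u)
  have htransport : parallelTransport (I := cylinderModel n) (G₀.cylinderMetric G₁).leviCivita
      (fun s : Icc (0 : ℝ) 1 ↦ (s, p)) ((0 : EuclideanSpace ℝ (Fin 1)), ((0 : ℝ), u)) =
      hex.choose 1 := dif_pos hex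
  rw [htransport]
  have hV := hex.choose_spec.1
  have hV0 := hex.choose_spec.2
  -- The chosen field need not be the explicit one; from here only parallelism and the initial value
  -- are used.
  generalize hex.choose = V at hV hV0
  obtain ⟨b, t, w, hV1⟩ : ∃ (b : EuclideanSpace ℝ (Fin 1)) (t : ℝ) (w : EuclideanSpace ℝ (Fin n)),
      V 1 = (b, (t, w)) := ⟨_, _, _, rfl⟩
  have hb : b = 0 := by
    have h := IsParallelAlong.final_fst hV hV0
    rwa [hV1] at h
  subst hb
  have ht : t = 0 := by
    have hl₀ := G₀.lapse_pos p
    have hl₁ := G₁.lapse_pos p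
    -- `∂_t` is also an eigenvector, with the ratio of squared lapses as positive eigenvalue: both
    -- metrics are negative there. Pairing with it kills the time component.
    have h := IsParallelAlong.final_eigen hV hV0 hV1 (a := G₀.lapse p ^ 2 / G₁.lapse p ^ 2)
      (by positivity) (e := ((1 : ℝ), 0)) (fun x ↦ by
        rw [spacetimeForm_zero_snd, spacetimeForm_zero_snd]
        field_simp)
    rw [spacetimeForm_zero_snd, spacetimeForm_zero_snd] at h
    simpa [hl₁.ne'] using h
  subst ht
  refine ⟨w, hV1, ?_⟩
  have hw : ∀ i, G₁.spatialLin p (e i) w = √(a i) * G₁.spatialLin p (e i) u := by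
    intro i
    have h := IsParallelAlong.final_eigen hV hV0 hV1 (ha i) (e := ((0 : ℝ), e i))
      (fun x ↦ by simpa using he' i 1 x)
    rwa [spacetimeForm_zero_fst, spacetimeForm_zero_fst] at h
  have hwu : G₁.spatialLin p w u = ∑ i, √(a i) * G₁.spatialLin p (e i) u ^ 2 := by
    conv_lhs => rw [← hsum u]
    rw [map_sum]
    refine Finset.sum_congr rfl fun i _ ↦ ?_
    have hs : G₁.spatialLin p w (e i) = G₁.spatialLin p (e i) w := G₁.spatial_symm p _ _
    rw [map_smul, hs, hw, smul_eq_mul]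
    ring
  rw [hwu]
  -- Some summand is strictly positive: otherwise the expansion of `u` would make it zero.
  obtain ⟨i, hi⟩ : ∃ i, G₁.spatialLin p (e i) u ≠ 0 := by
    by_contra! h
    exact hu (by simpa [h] using (hsum u).symm)
  refine Finset.sum_pos' (fun i _ ↦ by positivity) ⟨i, Finset.mem_univ i, ?_⟩
  have := Real.sqrt_pos.2 (ha i)
  positivity

/-- The outward unit normal is tangent to `S`. -/
lemma IsOutwardUnitNormal.exists_eq {p : ℝ × S} {N : TangentSpace (spacetimeModel n) p}
    (hN : G.IsOutwardUnitNormal p N) :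
    ∃ u : EuclideanSpace ℝ (Fin n), u ≠ 0 ∧ N = ((0 : ℝ), u) := by
  obtain ⟨c, u⟩ : ℝ × EuclideanSpace ℝ (Fin n) := N
  -- `∂_t` has no spatial part, so it is tangent to the boundary and the normal is orthogonal to it.
  have h := hN.normal ((1 : ℝ), (0 : EuclideanSpace ℝ (Fin n))) (by
    rw [spatialPart_apply]
    exact map_zero _)
  have h1 := ((G.spacetimeForm_symm p _ _).trans h)
  rw [spacetimeForm_zero_snd] at h1
  have hc : c = 0 := by simpa [(G.lapse_pos p).ne'] using h1
  subst hc
  refine ⟨u, ?_, rfl⟩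
  rintro rfl
  have h2 := hN.unit
  rw [spacetimeForm_zero_fst] at h2
  simp at h2

end SplitMetric
end Main
end

theorem lemma3p9 (n : ℕ) [NeZero n]
    (S : Type*) [TopologicalSpace S] [ChartedSpace (EuclideanHalfSpace n) S]
    [IsManifold (𝓡∂ n) ∞ S]
    (G₀ G₁ : SplitMetric n S) (p : ℝ × S) (hp : p ∈ (spacetimeModel n).boundary (ℝ × S))
    (N : TangentSpace (spacetimeModel n) p) (hN : G₁.IsOutwardUnitNormal p N) :
    (∃ u w : TangentSpace (𝓡∂ n) p.2,
      N = ofSpatial p u ∧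
      parallelTransport (G₀.cylinderMetric G₁).leviCivita (fun s ↦ (s, p)) (ofSlice 0 p N) =
        ofSlice 1 p (ofSpatial p w) ∧
      0 < G₁.spatial p w u) ∧
    ∀ μ : ℝ, μ < 0 →
      parallelTransport (G₀.cylinderMetric G₁).leviCivita (fun s ↦ (s, p)) (ofSlice 0 p N) ≠
        μ • ofSlice 1 p N := by
  obtain ⟨u, hu, rfl⟩ := hN.exists_eq
  obtain ⟨w, hw, hpos⟩ := SplitMetric.parallelTransport_ofSpatial (G₀ := G₀) (G₁ := G₁) p hu
  have h0 := ofSlice_apply (n := n) 0 p ((0 : ℝ), u)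
  have htr : parallelTransport (G₀.cylinderMetric G₁).leviCivita (fun s ↦ (s, p))
      (ofSlice 0 p ((0 : ℝ), u)) = ((0 : EuclideanSpace ℝ (Fin 1)), ((0 : ℝ), w)) :=
    (congrArg _ h0).trans hw
  refine ⟨⟨u, w, (ofSpatial_apply p u).symm, ?_, hpos⟩, fun μ hμ h ↦ ?_⟩
  · exact htr.trans ((congrArg _ (ofSpatial_apply p w)).trans (ofSlice_apply 1 p (0, w))).symm
  · have h1 := htr.symm.trans (h.trans (congrArg (μ • ·) (ofSlice_apply (n := n) 1 p (0, u))))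
    -- Comparing spatial components would give `h₁(w, u) = μ h₁(u, u) < 0`.
    have h2 : w = μ • u := congrArg
      (fun x : EuclideanSpace ℝ (Fin 1) × (ℝ × EuclideanSpace ℝ (Fin n)) ↦ x.2.2) h1
    rw [h2, map_smul, LinearMap.smul_apply, smul_eq_mul] at hpos
    have huu : 0 < G₁.spatialLin p u u := G₁.spatial_pos p u hu
    nlinarith
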